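/- Let $\mathbb{F}$ be a totally ordered field. A \emph{line arrangement} is a finite family $L_1,\dots,L_n$ of lines in $\mathbb{F}^2$, no two parallel (or equal) and no three concurrent. A map $\mathbb{F}^2\to\mathbb{F}^2$ is \emph{piecewise linear} if $\mathbb{F}^2$ is a finite union of polyhedral sets (finite intersections of closed half-planes) on each of which the map is affine; a \emph{piecewise linear automorphism} is a bijection that is piecewise linear together with its inverse. A bijection between the lines of two arrangements is an \emph{isomorphism} if some piecewise linear automorphism of $\mathbb{F}^2$ maps every line of the first arrangement onto the corresponding line of the second. The \emph{inner coordinate}, on a line $L$ of an arrangement of $n$ lines, of an intersection point on $L$ is its position $1,\dots,n-1$ among the intersection points on $L$ (along either orientation), taken modulo $n$ and hence well defined up to sign. The \emph{nook point} of an arrangement of four lines is the unique intersection point neither of whose two inner coordinates is $\pm1 \bmod 4$, i.e. the point lying between the two other intersection points on both lines through it. Let $L_1,\dots,L_n$ and $M_1,\dots,M_n$ be two line arrangements in $\mathbb{F}^2$, each indexed in the order of increasing slope $0\to\infty\to-\infty\to0$ (first the slopes $\ge 0$ increasingly, then $\infty$, then the slopes $<0$ increasingly). Then the bijection $\phi\colon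 L_i\mapsto M_i$ (with $L_i\cap L_j\mapsto M_i\cap M_j$) is an isomorphism of line arrangements if and only if for all distinct $i,j,k,l$ it maps the nook point of $\{L_i,L_j,L_k,L_l\}$ to the nook point of $\{M_i,M_j,M_k,M_l\}$. Moreover, in this case, and more generally whenever for some integer $j$ the bijection $L_i\mapsto M_{i+j}$ (subscripts modulo $n$) is an isomorphism of line arrangements, either one of the two arrangements can be cyclically renumbered (the other one being kept) so that afterwards, for any four subscripts, the nook points of the two corresponding quadruples of lines are intersections of lines with the same two subscripts. -/

import Mathlib

namespace LineArr

variable {F : Type*} [Field F] [LinearOrder F] [IsStrictOrderedRing F]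

/-- A finite indexed family of lines in the plane `F × F` in generic position:
no two lines are parallel (in particular no two coincide), no three are concurrent. -/
structure IsLineArrangement {n : ℕ} (L : Fin n → AffineSubspace F (F × F)) : Prop where
  isLine : ∀ i, Module.finrank F (L i).direction = 1
  notParallel : ∀ i j, i ≠ j → ¬ (L i).Parallel (L j)
  notConcurrent : ∀ i j k, i ≠ j → j ≠ k → i ≠ k →
    ¬ ∃ P : F × F, P ∈ L i ∧ P ∈ L j ∧ P ∈ L k

/-- `HasSlope l m`: the line `l` has slope `m ∈ F ∪ {∞}`; `⊤` is the slope of vertical lines. -/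
def HasSlope (l : AffineSubspace F (F × F)) (m : WithTop F) : Prop :=
  (∃ a : F, m = (a : WithTop F) ∧ ((1 : F), a) ∈ l.direction) ∨
    (m = ⊤ ∧ ((0 : F), (1 : F)) ∈ l.direction)

/-- The slope order `0 → ∞ → -∞ → 0`: first the slopes `≥ 0` in increasing order, then `∞`,
then the slopes `< 0` in increasing order. -/
def SlopeLT (s t : WithTop F) : Prop :=
  (0 ≤ s ∧ 0 ≤ t ∧ s < t) ∨ (0 ≤ s ∧ t < 0) ∨ (s < 0 ∧ t < 0 ∧ s < t)

/-- The lines are indexed by increasing slope in the order `0 → ∞ → -∞ → 0`. -/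
def SlopeOrdered {n : ℕ} (L : Fin n → AffineSubspace F (F × F)) : Prop :=
  ∃ m : Fin n → WithTop F, (∀ i, HasSlope (L i) (m i)) ∧ ∀ i j, i < j → SlopeLT (m i) (m j)

/-- The position of the point `P` of `L i` among the intersection points of `L i` with the other
lines, when `L i` is oriented by the vector `w`: the number of the lines `L j`, `j ≠ i`, that
meet `L i` at `P` or before `P`. -/
noncomputable def position {n : ℕ} (L : Fin n → AffineSubspace F (F × F)) (i : Fin n)
    (w P : F × F) : ℕ :=
  Set.ncard {j : Fin n | j ≠ i ∧ ∃ t : F, 0 ≤ t ∧ P - t • w ∈ L j}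

/-- `c` is an inner coordinate modulo `n` of the point `P` on the line `L i`, for one of the two
orientations of that line. (The other orientation gives `-c`.) -/
def IsInnerCoord {n : ℕ} (L : Fin n → AffineSubspace F (F × F)) (i : Fin n)
    (P : F × F) (c : ZMod n) : Prop :=
  ∃ w : F × F, w ∈ (L i).direction ∧ w ≠ 0 ∧ c = (position L i w P : ZMod n)

/-- `P` is a nook point of the four lines `Q`: an intersection point none of whose inner
coordinates is `± 1` modulo `4`. -/
def IsNookPoint (Q : Fin 4 → AffineSubspace F (F × F)) (P : F × F) : Prop :=
  (∃ i j, i ≠ j ∧ P ∈ Q i ∧ P ∈ Q j) ∧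
    ∀ i, P ∈ Q i → ∀ c : ZMod 4, IsInnerCoord Q i P c → c ≠ 1 ∧ c ≠ -1

/-- A polyhedral subset of the plane: a finite intersection of closed half-planes
`a x + b y ≤ c`. -/
def IsPolyhedral (K : Set (F × F)) : Prop :=
  ∃ s : Finset (F × F × F), K = {p | ∀ h ∈ s, h.1 * p.1 + h.2.1 * p.2 ≤ h.2.2}

/-- A map of the plane is piecewise linear if the plane is a finite union of polyhedral sets on
each of which the map agrees with an affine map. -/
def IsPiecewiseLinear (f : F × F → F × F) : Prop :=
  ∃ 𝒦 : Set (Set (F × F)), 𝒦.Finite ∧ ⋃₀ 𝒦 = Set.univ ∧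
    ∀ K ∈ 𝒦, IsPolyhedral K ∧ ∃ g : (F × F) →ᵃ[F] (F × F), Set.EqOn f g K

/-- The bijection `L i ↦ M (φ i)` of two families of lines is an isomorphism: it is induced by a
piecewise linear automorphism of the plane. -/
def IsIsomorphism {n : ℕ} (L M : Fin n → AffineSubspace F (F × F))
    (φ : Equiv.Perm (Fin n)) : Prop :=
  ∃ e : (F × F) ≃ (F × F), IsPiecewiseLinear e ∧ IsPiecewiseLinear e.symm ∧
    ∀ i, e '' (L i : Set (F × F)) = (M (φ i) : Set (F × F))

/-- The bijection `L i ↦ M (φ i)`, which maps the intersection point of `L i`, `L j` to that of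
`M (φ i)`, `M (φ j)`, preserves the nook points of all subsets of four lines. -/
def PreservesNookPoints {n : ℕ} (L M : Fin n → AffineSubspace F (F × F))
    (φ : Equiv.Perm (Fin n)) : Prop :=
  ∀ q : Fin 4 ↪ Fin n, ∀ i j : Fin 4, i ≠ j → ∀ P P' : F × F,
    P ∈ L (q i) → P ∈ L (q j) → P' ∈ M (φ (q i)) → P' ∈ M (φ (q j)) →
      (IsNookPoint (fun r => L (q r)) P ↔ IsNookPoint (fun r => M (φ (q r))) P')

/-- The nook point of the four lines `Q` is the intersection of the lines with subscripts
`i` and `j`. -/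
def NookAt (Q : Fin 4 → AffineSubspace F (F × F)) (i j : Fin 4) : Prop :=
  i ≠ j ∧ ∃ P : F × F, P ∈ Q i ∧ P ∈ Q j ∧ IsNookPoint Q P

/-- For any four subscripts, the nook points of the two corresponding quadruples are the
intersections of lines with the same two subscripts. -/
def IdenticalNookPoints {n : ℕ} (L M : Fin n → AffineSubspace F (F × F)) : Prop :=
  ∀ q : Fin 4 ↪ Fin n, ∀ i j : Fin 4,
    NookAt (fun r => L (q r)) i j ↔ NookAt (fun r => M (q r)) i j

/-- Cyclic renumbering by `k`: the line with the new subscript `i` is the line with the old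
subscript `i + k` modulo `n`. -/
def renumber {n : ℕ} (k : ℤ) (L : Fin n → AffineSubspace F (F × F)) :
    Fin n → AffineSubspace F (F × F) :=
  fun i => L ((finRotate n ^ k) i)

end LineArr

/-!
The theorem holds because the nook points of an arrangement with sorted slopes carry the same
information as its order type, and the order type decides the piecewise linear class.

*Isomorphisms preserve nook points.* The restriction of a piecewise linear injection to a line is
strictly monotone: piecewise linear functions of one variable satisfy the intermediate value
theorem over any ordered field (`IsPiecewiseLinear₁.exists_eq`). Hence betweenness on the lines is
preserved (`IsPiecewiseLinear.sbtw`). The nook point of four lines is the intersection point that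
lies between the other two on both of its lines, so it is preserved as well (`IsNookPoint.map`).
This holds for every bijection of the lines, which gives the statement about cyclic renumbering.

*Nook points determine orientations.* Write the lines as `cross (d i) p = γ i` with directions `d i`
at increasing angles in `[0, π)`. The orientation of the triangle `i`, `j`, `k` is the sign of
`tripleDet d γ i j k`. If the slopes of `a`, `b` do not interleave with those of `c`, `e`, then
whether the nook point of the four lines is that of `a` and `b` tells whether the triangles `abc`
and `abe` have the same orientation; at most one of the three pairings of four slopes is interleaved
(`cross_pairings`). So two arrangements with the same nook points have the same orientations, or
opposite ones throughout (`tripleDet_mul_pos_or_neg`); a half-turn interchanges the two cases.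

*Orientations determine the arrangement.* The lines and the line at infinity become planes through
the origin of `F × F × F`. Equal orientations of all triples give equal sign vectors: by Helly's
theorem it suffices to look at four planes, and there the linear dependences have coefficients of
the same signs (`exists_signVec_eq`). Two essential hyperplane arrangements with the same sign
vectors are related by a map of barycentric subdivisions: choose a point `u σ` in each cell of the
one and `u' σ` in the corresponding cell of the other; every point is uniquely a positive
combination of points `u σ` along a chain of faces, and one sends it to the same combination of the
`u' σ` (`exists_conic_equiv`). If the points are chosen with equal values of the form that defines
the plane at infinity, this map restricts to the affine plane.
-/

set_option linter.unusedSectionVars false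

namespace LineArr

variable {F : Type*} [Field F] [LinearOrder F] [IsStrictOrderedRing F]

/-! ### Piecewise linear maps preserve betweenness -/

/-- Piecewise linearity for functions of one variable: the analogue of `IsPiecewiseLinear`, the
pieces being finite intersections of closed half-lines `a t ≤ c`. -/
def IsPiecewiseLinear₁ (g : F → F) : Prop :=
  ∃ 𝒦 : Set (Set F), 𝒦.Finite ∧ ⋃₀ 𝒦 = Set.univ ∧
    ∀ K ∈ 𝒦, (∃ s : Finset (F × F), K = {t | ∀ h ∈ s, h.1 * t ≤ h.2}) ∧
      ∃ α β : F, ∀ t ∈ K, g t = α * t + β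

lemma IsPiecewiseLinear₁.neg {g : F → F} (hg : IsPiecewiseLinear₁ g) :
    IsPiecewiseLinear₁ fun t => -g t := by
  obtain ⟨𝒦, hfin, hcov, h⟩ := hg
  refine ⟨𝒦, hfin, hcov, fun K hK => ⟨(h K hK).1, ?_⟩⟩
  obtain ⟨α, β, hαβ⟩ := (h K hK).2
  refine ⟨-α, -β, fun t ht => ?_⟩
  linear_combination -hαβ t ht

lemma IsPiecewiseLinear₁.comp_neg {g : F → F} (hg : IsPiecewiseLinear₁ g) :
    IsPiecewiseLinear₁ fun t => g (-t) := by
  classical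
  obtain ⟨𝒦, hfin, hcov, h⟩ := hg
  refine ⟨(fun K => {t | -t ∈ K}) '' 𝒦, hfin.image _, ?_, ?_⟩
  · refine Set.eq_univ_of_forall fun t => ?_
    obtain ⟨K, hK, ht⟩ : -t ∈ ⋃₀ 𝒦 := hcov ▸ Set.mem_univ _
    exact ⟨_, ⟨K, hK, rfl⟩, ht⟩
  · rintro _ ⟨K, hK, rfl⟩
    obtain ⟨⟨s, rfl⟩, α, β, hαβ⟩ := h K hK
    refine ⟨⟨s.image fun h => (-h.1, h.2), ?_⟩, -α, β, fun t ht => ?_⟩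
    · ext t
      simp only [Set.mem_ofPred_eq, Finset.forall_mem_image]
      exact forall₂_congr fun h _ => by rw [mul_neg, neg_mul]
    · linear_combination hαβ (-t) ht

/-- A nonempty closed one-dimensional polyhedron that is bounded above has a greatest element. -/
lemma exists_isGreatest_polyhedron (s : Finset (F × F)) (b : F)
    (hne : {t : F | ∀ h ∈ s, h.1 * t ≤ h.2}.Nonempty)
    (hb : ∃ c, 0 < c ∧ (c, b) ∈ s) :
    ∃ m, IsGreatest {t : F | ∀ h ∈ s, h.1 * t ≤ h.2} m := by
  obtain ⟨c, hc, hcs⟩ := hb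
  obtain ⟨t₁, ht₁⟩ := hne
  -- The greatest element is the least of the bounds `h.2 / h.1` with `0 < h.1`.
  obtain ⟨h₀, hh₀, hmin⟩ := Finset.exists_min_image (s.filter fun h => 0 < h.1)
    (fun h => h.2 / h.1) ⟨(c, b), Finset.mem_filter.2 ⟨hcs, hc⟩⟩
  rw [Finset.mem_filter] at hh₀
  have hle : ∀ t ∈ {t : F | ∀ h ∈ s, h.1 * t ≤ h.2}, t ≤ h₀.2 / h₀.1 := fun t ht => by
    rw [le_div_iff₀' hh₀.2]; exact ht h₀ hh₀.1
  refine ⟨h₀.2 / h₀.1, fun h hh => ?_, hle⟩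
  rcases lt_or_ge 0 h.1 with hpos | hneg
  · have := hmin h (Finset.mem_filter.2 ⟨hh, hpos⟩)
    rwa [le_div_iff₀' hpos] at this
  · exact (mul_le_mul_of_nonpos_left (hle t₁ ht₁) hneg).trans (ht₁ h hh)

lemma IsPiecewiseLinear₁.exists_isGreatest {g : F → F} (hg : IsPiecewiseLinear₁ g) (a b c : F)
    (hne : {t | a ≤ t ∧ t ≤ b ∧ g t ≤ c}.Nonempty) :
    ∃ m, IsGreatest {t | a ≤ t ∧ t ≤ b ∧ g t ≤ c} m := by
  classical
  obtain ⟨𝒦, hfin, hcov, h⟩ := hg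
  set S := {t | a ≤ t ∧ t ≤ b ∧ g t ≤ c} with hS
  have key : ∀ K ∈ 𝒦, (S ∩ K).Nonempty → ∃ m, IsGreatest (S ∩ K) m := by
    intro K hK hKne
    obtain ⟨⟨s, rfl⟩, α, β, hαβ⟩ := h K hK
    have heq : S ∩ {t | ∀ h ∈ s, h.1 * t ≤ h.2} =
        {t | ∀ h ∈ insert (1, b) (insert (-1, -a) (insert (α, c - β) s)), h.1 * t ≤ h.2} := by
      ext t
      simp only [hS, Set.mem_inter_iff, Set.mem_ofPred_eq, Finset.forall_mem_insert, one_mul,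
        neg_mul, neg_le_neg_iff]
      constructor
      · rintro ⟨⟨h1, h2, h3⟩, h4⟩
        rw [hαβ t h4] at h3
        exact ⟨h2, h1, by linarith, h4⟩
      · rintro ⟨h2, h1, h3, h4⟩
        refine ⟨⟨h1, h2, ?_⟩, h4⟩
        rw [hαβ t h4]; linarith
    rw [heq] at hKne ⊢
    exact exists_isGreatest_polyhedron _ b hKne ⟨1, one_pos, Finset.mem_insert_self _ _⟩
  choose! m hm using key
  obtain ⟨t₁, ht₁⟩ := hne
  have hmem : ∀ t : F, ∃ K ∈ 𝒦, t ∈ K := fun t =>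
    (hcov ▸ Set.mem_univ t : t ∈ ⋃₀ 𝒦)
  obtain ⟨K₁, hK₁, ht₁K⟩ := hmem t₁
  obtain ⟨K₀, ⟨hK₀, hne₀⟩, hmax⟩ := Set.exists_max_image {K | K ∈ 𝒦 ∧ (S ∩ K).Nonempty} m
    (hfin.subset fun K hK => hK.1) ⟨K₁, hK₁, t₁, ht₁, ht₁K⟩
  refine ⟨m K₀, (hm K₀ hK₀ hne₀).1.1, fun t ht => ?_⟩
  obtain ⟨K, hK, htK⟩ := hmem t
  exact ((hm K hK ⟨t, ht, htK⟩).2 ⟨ht, htK⟩).trans (hmax K ⟨hK, t, ht, htK⟩)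

/-- The intermediate value theorem for piecewise linear functions. It needs no completeness of
`F`: the sets `{g ≤ c}` and `{c ≤ g}` are finite unions of closed intervals. -/
lemma IsPiecewiseLinear₁.exists_eq {g : F → F} (hg : IsPiecewiseLinear₁ g) {a b c : F}
    (hab : a ≤ b) (ha : g a ≤ c) (hb : c ≤ g b) : ∃ t, a ≤ t ∧ t ≤ b ∧ g t = c := by
  obtain ⟨t₀, ⟨h1, h2, h3⟩, ht₀⟩ := hg.exists_isGreatest a b c ⟨a, le_rfl, hab, ha⟩
  obtain ⟨t₁, ⟨h4, h5, h6⟩, ht₁⟩ := hg.comp_neg.neg.exists_isGreatest (-b) (-t₀) (-c)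
    ⟨-b, le_rfl, neg_le_neg h2, by simpa using hb⟩
  -- `-t₁` is the least point of `[t₀, b]` at which `c ≤ g`; it is `t₀`, since every point of
  -- `(t₀, b]` is such a point.
  have : t₀ = -t₁ := by
    by_contra hne
    have hlt : t₀ < -t₁ := lt_of_le_of_ne (by linarith) hne
    obtain ⟨u, hu1, hu2⟩ := exists_between hlt
    have hcu : c ≤ g u := by
      by_contra hcu
      exact absurd (ht₀ ⟨h1.trans hu1.le, by linarith, (not_le.1 hcu).le⟩) (not_le.2 hu1)
    have := ht₁ (a := -u) ⟨by linarith, by linarith, by simpa using hcu⟩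
    linarith
  refine ⟨t₀, h1, h2, le_antisymm h3 ?_⟩
  rw [this]; linarith

lemma IsPiecewiseLinear₁.not_peak {g : F → F} (hg : IsPiecewiseLinear₁ g)
    (hinj : Function.Injective g) {x y z : F} (hxy : x < y) (hyz : y < z)
    (h1 : g x < g y) (h2 : g z < g y) : False := by
  rcases le_total (g x) (g z) with h | h
  · obtain ⟨t, -, hty, ht⟩ := hg.exists_eq hxy.le h h2.le
    have := hinj ht
    linarith
  · obtain ⟨t, hty, -, ht⟩ := hg.neg.exists_eq (c := -g x) hyz.le (by linarith) (by linarith)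
    have := hinj (neg_injective ht)
    linarith

lemma IsPiecewiseLinear₁.lt_lt_or_gt_gt {g : F → F} (hg : IsPiecewiseLinear₁ g)
    (hinj : Function.Injective g) {x y z : F} (hxy : x < y) (hyz : y < z) :
    (g x < g y ∧ g y < g z) ∨ (g z < g y ∧ g y < g x) := by
  rcases lt_or_gt_of_ne (hinj.ne hxy.ne) with h1 | h1 <;>
    rcases lt_or_gt_of_ne (hinj.ne hyz.ne) with h2 | h2
  · exact .inl ⟨h1, h2⟩
  · exact (hg.not_peak hinj hxy hyz h1 h2).elim
  · exact (hg.neg.not_peak (neg_injective.comp hinj) hxy hyz (neg_lt_neg h1)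
      (neg_lt_neg h2)).elim
  · exact .inr ⟨h2, h1⟩

/-- The restriction of a piecewise linear map to a line, followed by a linear form, is piecewise
linear. -/
lemma IsPiecewiseLinear.restrict_line {f : F × F → F × F} (hf : IsPiecewiseLinear f)
    (A v : F × F) (φ : F × F →ₗ[F] F) :
    IsPiecewiseLinear₁ fun t : F => φ (f (A + t • v)) := by
  classical
  obtain ⟨𝒦, hfin, hcov, h⟩ := hf
  refine ⟨(fun K => {t | A + t • v ∈ K}) '' 𝒦, hfin.image _, ?_, ?_⟩
  · refine Set.eq_univ_of_forall fun t => ?_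
    obtain ⟨K, hK, ht⟩ : A + t • v ∈ ⋃₀ 𝒦 := hcov ▸ Set.mem_univ _
    exact ⟨_, ⟨K, hK, rfl⟩, ht⟩
  · rintro _ ⟨K, hK, rfl⟩
    obtain ⟨⟨s, rfl⟩, g, hg⟩ := h K hK
    refine ⟨⟨s.image fun h =>
      (h.1 * v.1 + h.2.1 * v.2, h.2.2 - h.1 * A.1 - h.2.1 * A.2), ?_⟩,
      φ (g.linear v), φ (g A), fun t ht => ?_⟩
    · ext t
      simp only [Set.mem_ofPred_eq, Finset.forall_mem_image, Prod.fst_add, Prod.snd_add,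
        Prod.smul_fst, Prod.smul_snd, smul_eq_mul]
      refine forall₂_congr fun h _ => ⟨fun h => ?_, fun h => ?_⟩ <;> linarith
    · have : g (A + t • v) = t • g.linear v + g A := by
        rw [add_comm A, ← vadd_eq_add, g.map_vadd]; simp
      have h2 : f (A + t • v) = g (A + t • v) := hg ht
      simp only [h2, this, map_add, map_smul, smul_eq_mul]
      ring

/-- The determinant of two vectors of the plane. -/
def cross (u v : F × F) : F := u.1 * v.2 - u.2 * v.1

lemma eq_of_cross_eq_of_dot_eq {d p q : F × F} (hd : d ≠ 0) (h1 : cross d p = cross d q)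
    (h2 : d.1 * p.1 + d.2 * p.2 = d.1 * q.1 + d.2 * q.2) : p = q := by
  have hpos : d.1 ^ 2 + d.2 ^ 2 ≠ 0 := by
    intro h
    have h1 : d.1 = 0 := by nlinarith [sq_nonneg d.1, sq_nonneg d.2]
    have h2 : d.2 = 0 := by nlinarith [sq_nonneg d.1, sq_nonneg d.2]
    exact hd (Prod.ext h1 h2)
  unfold cross at h1
  refine Prod.ext (mul_left_cancel₀ hpos ?_) (mul_left_cancel₀ hpos ?_)
  · linear_combination d.1 * h2 - d.2 * h1
  · linear_combination d.2 * h2 + d.1 * h1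

/-- An injective piecewise linear map that sends a line into a line preserves strict betweenness on
it. -/
lemma IsPiecewiseLinear.sbtw {f : F × F → F × F} (hf : IsPiecewiseLinear f)
    (hinj : Function.Injective f) {A B C d : F × F} {γ : F} (hd : d ≠ 0)
    (hline : ∀ t : F, cross d (f (A + t • (C - A))) = γ) (h : Sbtw F A B C) :
    Sbtw F (f A) (f B) (f C) := by
  obtain ⟨⟨s, ⟨hs0, hs1⟩, rfl⟩, hBA, hBC⟩ := h
  have hAC : C - A ≠ 0 := by
    intro h0
    apply hBA
    rw [AffineMap.lineMap_apply, vsub_eq_sub, h0]; simp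
  have hB : AffineMap.lineMap A C s = A + s • (C - A) := by
    rw [AffineMap.lineMap_apply, vsub_eq_sub, vadd_eq_add, add_comm]
  rw [hB] at hBA hBC ⊢
  have hs0' : 0 < s := lt_of_le_of_ne hs0 fun h0 => hBA (by simp [← h0])
  have hs1' : s < 1 := lt_of_le_of_ne hs1 fun h0 => hBC (by simp [h0])
  set φ : F × F →ₗ[F] F := d.1 • LinearMap.fst F F F + d.2 • LinearMap.snd F F F with hφ
  have hφ' : ∀ p, φ p = d.1 * p.1 + d.2 * p.2 := fun p => by simp [hφ]
  set g : F → F := fun t => φ (f (A + t • (C - A))) with hg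
  have hginj : Function.Injective g := by
    intro t t' htt
    have h1 := hinj (eq_of_cross_eq_of_dot_eq hd ((hline t).trans (hline t').symm)
      (by rw [← hφ', ← hφ']; exact htt))
    exact smul_left_injective F hAC (add_left_cancel h1)
  have hA : f A = f (A + (0 : F) • (C - A)) := by simp
  have hC : f C = f (A + (1 : F) • (C - A)) := by simp
  have hg01 : g 1 - g 0 ≠ 0 := sub_ne_zero.2 (hginj.ne one_ne_zero)
  have hbt := (hf.restrict_line A (C - A) φ).lt_lt_or_gt_gt hginj hs0' hs1'
  change (g 0 < g s ∧ g s < g 1) ∨ (g 1 < g s ∧ g s < g 0) at hbt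
  refine ⟨⟨(g s - g 0) / (g 1 - g 0), ?_, ?_⟩, fun h => hBA (hinj h), fun h => hBC (hinj h)⟩
  · rcases hbt with h | h
    · exact ⟨div_nonneg (by linarith) (by linarith),
        (div_le_one (by linarith)).2 (by linarith)⟩
    · exact ⟨div_nonneg_of_nonpos (by linarith) (by linarith),
        (div_le_one_of_neg (by linarith)).2 (by linarith)⟩
  · rw [AffineMap.lineMap_apply, vsub_eq_sub, vadd_eq_add, add_comm]
    have c0 := hline 0
    have c1 := hline 1
    have cs := hline s
    have e0 : g 0 = _ := hφ' (f (A + (0 : F) • (C - A)))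
    have e1 : g 1 = _ := hφ' (f (A + (1 : F) • (C - A)))
    have es : g s = _ := hφ' (f (A + s • (C - A)))
    rw [← hA] at c0 e0
    rw [← hC] at c1 e1
    unfold cross at c0 c1 cs
    refine eq_of_cross_eq_of_dot_eq hd ?_ ?_
    · simp only [cross, Prod.fst_add, Prod.snd_add, Prod.smul_fst, Prod.smul_snd, smul_eq_mul,
        Prod.fst_sub, Prod.snd_sub]
      linear_combination c0 - cs + (g s - g 0) / (g 1 - g 0) * (c1 - c0)
    · simp only [Prod.fst_add, Prod.snd_add, Prod.smul_fst, Prod.smul_snd, smul_eq_mul,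
        Prod.fst_sub, Prod.snd_sub]
      have hq : (g s - g 0) / (g 1 - g 0) * (g 1 - g 0) = g s - g 0 := div_mul_cancel₀ _ hg01
      linear_combination hq + es - e0 - (g s - g 0) / (g 1 - g 0) * (e1 - e0)

/-! ### Equations of lines and nook points -/

/-- The lines `L i` are given by the equations `cross (d i) p = γ i`, where `d i` is a direction
vector of `L i`, and they are in generic position. -/
structure IsGenericSystem {ι : Type*} (L : ι → AffineSubspace F (F × F)) (d : ι → F × F)
    (γ : ι → F) : Prop where
  ne_zero : ∀ i, d i ≠ 0
  mem_iff : ∀ i p, p ∈ L i ↔ cross (d i) p = γ i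
  mem_direction_iff : ∀ i w, w ∈ (L i).direction ↔ cross (d i) w = 0
  cross_ne_zero : ∀ i j, i ≠ j → cross (d i) (d j) ≠ 0
  not_concurrent : ∀ i j k, i ≠ j → j ≠ k → i ≠ k →
    ∀ p, cross (d i) p = γ i → cross (d j) p = γ j → cross (d k) p ≠ γ k

lemma IsGenericSystem.comp {ι κ : Type*} {L : ι → AffineSubspace F (F × F)} {d : ι → F × F}
    {γ : ι → F} (h : IsGenericSystem L d γ) {q : κ → ι} (hq : Function.Injective q) :
    IsGenericSystem (fun r => L (q r)) (fun r => d (q r)) (fun r => γ (q r)) where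
  ne_zero _ := h.ne_zero _
  mem_iff _ := h.mem_iff _
  mem_direction_iff _ := h.mem_direction_iff _
  cross_ne_zero _ _ hij := h.cross_ne_zero _ _ (hq.ne hij)
  not_concurrent _ _ _ hij hjk hik := h.not_concurrent _ _ _ (hq.ne hij) (hq.ne hjk) (hq.ne hik)

lemma exists_eq_smul_of_cross_eq_zero {d w : F × F} (hd : d ≠ 0) (h : cross d w = 0) :
    ∃ s : F, w = s • d := by
  unfold cross at h
  by_cases h1 : d.1 = 0
  · have h2 : d.2 ≠ 0 := fun h2 => hd (Prod.ext h1 h2)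
    refine ⟨w.2 / d.2, Prod.ext ?_ ?_⟩
    · simp only [Prod.smul_fst, smul_eq_mul, h1, mul_zero]
      rw [h1, zero_mul, zero_sub, neg_eq_zero] at h
      exact (mul_eq_zero.1 h).resolve_left h2
    · simp [h2]
  · refine ⟨w.1 / d.1, Prod.ext ?_ ?_⟩
    · simp [h1]
    · simp only [Prod.smul_snd, smul_eq_mul]
      field_simp
      linear_combination h

/-- Two lines that are not parallel meet. -/
lemma exists_cross_eq {d d' : F × F} (h : cross d d' ≠ 0) (γ γ' : F) :
    ∃ p, cross d p = γ ∧ cross d' p = γ' := by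
  have key := mul_inv_cancel₀ h
  refine ⟨(cross d d')⁻¹ • (γ • d' - γ' • d), ?_, ?_⟩
  · generalize (cross d d')⁻¹ = c at key ⊢
    simp only [cross, Prod.smul_fst, Prod.smul_snd, Prod.fst_sub, Prod.snd_sub,
      smul_eq_mul] at key ⊢
    linear_combination γ * key
  · generalize (cross d d')⁻¹ = c at key ⊢
    simp only [cross, Prod.smul_fst, Prod.smul_snd, Prod.fst_sub, Prod.snd_sub,
      smul_eq_mul] at key ⊢
    linear_combination γ' * key

/-- The canonical direction vector of a line of slope `m`: the one in the half-open upper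
half-plane, at an angle in `[0, π)`. -/
lemma exists_direction {l : AffineSubspace F (F × F)} {m : WithTop F} (h : HasSlope l m) :
    ∃ d ∈ l.direction, (∃ a : F, m = a ∧ 0 ≤ a ∧ d = (1, a)) ∨
      (∃ a : F, m = a ∧ a < 0 ∧ d = (-1, -a)) ∨ (m = ⊤ ∧ d = (0, 1)) := by
  rcases h with ⟨a, hm, ha⟩ | ⟨hm, h⟩
  · rcases le_or_gt 0 a with h0 | h0
    · exact ⟨_, ha, .inl ⟨a, hm, h0, rfl⟩⟩
    · refine ⟨_, l.direction.neg_mem ha, .inr (.inl ⟨a, hm, h0, by simp⟩)⟩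
  · exact ⟨_, h, .inr (.inr ⟨hm, rfl⟩)⟩

lemma exists_isGenericSystem {n : ℕ} {L : Fin n → AffineSubspace F (F × F)}
    (hL : IsLineArrangement L) (hs : SlopeOrdered L) :
    ∃ d γ, IsGenericSystem L d γ ∧ ∀ i j, i < j → 0 < cross (d i) (d j) := by
  obtain ⟨m, hm, hlt⟩ := hs
  choose d hdir hd using fun i => exists_direction (hm i)
  have hne : ∀ i, (L i : Set (F × F)).Nonempty := by
    intro i
    rw [AffineSubspace.nonempty_iff_ne_bot]
    intro h
    have := hL.isLine i
    rw [h, AffineSubspace.direction_bot, finrank_bot] at this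
    exact zero_ne_one this
  choose p₀ hp₀ using hne
  have hd0 : ∀ i, d i ≠ 0 := by
    intro i
    rcases hd i with ⟨a, -, -, h⟩ | ⟨a, -, -, h⟩ | ⟨-, h⟩ <;> simp [h, Prod.ext_iff]
  have hdiriff : ∀ i w, w ∈ (L i).direction ↔ cross (d i) w = 0 := by
    refine fun i w => ⟨fun hw => ?_, fun hw => ?_⟩
    · obtain ⟨s, hs⟩ := (finrank_eq_one_iff_of_nonzero' (⟨d i, hdir i⟩ : (L i).direction)
        (by simpa using hd0 i)).1 (hL.isLine i) ⟨w, hw⟩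
      have hs' : s • d i = w := congrArg Subtype.val hs
      rw [← hs']
      simp only [cross, Prod.smul_fst, Prod.smul_snd, smul_eq_mul]
      ring
    · obtain ⟨s, rfl⟩ := exists_eq_smul_of_cross_eq_zero (hd0 i) hw
      exact (L i).direction.smul_mem s (hdir i)
  have hmem : ∀ i p, p ∈ L i ↔ cross (d i) p = cross (d i) (p₀ i) := by
    intro i p
    rw [← AffineSubspace.vsub_right_mem_direction_iff_mem (hp₀ i), hdiriff]
    simp only [cross, vsub_eq_sub, Prod.fst_sub, Prod.snd_sub]
    constructor <;> intro h <;> linear_combination h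
  have hpos : ∀ i j, i < j → 0 < cross (d i) (d j) := by
    intro i j hij
    have h := hlt i j hij
    unfold SlopeLT at h
    rcases hd i with ⟨a, hma, ha, hda⟩ | ⟨a, hma, ha, hda⟩ | ⟨hma, hda⟩ <;>
      rcases hd j with ⟨b, hmb, hb, hdb⟩ | ⟨b, hmb, hb, hdb⟩ | ⟨hmb, hdb⟩ <;>
      rw [hda, hdb] <;> rw [hma, hmb] at h <;> simp [cross] at h ⊢ <;>
      first | linarith | (norm_cast at h; grind)
  have hcross : ∀ i j, i ≠ j → cross (d i) (d j) ≠ 0 := by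
    intro i j hij h0
    rcases lt_or_gt_of_ne hij with h | h
    · exact (hpos i j h).ne' h0
    · refine (hpos j i h).ne' ?_
      unfold cross at h0 ⊢
      linear_combination -h0
  refine ⟨d, fun i => cross (d i) (p₀ i), ⟨hd0, hmem, hdiriff, hcross, ?_⟩, hpos⟩
  intro i j k hij hjk hik p hi hj hk
  exact hL.notConcurrent i j k hij hjk hik
    ⟨p, (hmem i p).2 hi, (hmem j p).2 hj, (hmem k p).2 hk⟩

/-- The determinant that decides the orientation of the triangle formed by three lines. -/
def tripleDet {ι : Type*} (d : ι → F × F) (γ : ι → F) (i j k : ι) : F :=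
  γ i * cross (d j) (d k) - γ j * cross (d i) (d k) + γ k * cross (d i) (d j)

lemma sub_mul_cross_eq_neg_tripleDet {ι : Type*} {d : ι → F × F} {γ : ι → F} {i j k : ι}
    {p : F × F} (hi : cross (d i) p = γ i) (hj : cross (d j) p = γ j) :
    (cross (d k) p - γ k) * cross (d i) (d j) = -tripleDet d γ i j k := by
  simp only [tripleDet, ← hi, ← hj]
  simp only [cross]
  ring

lemma IsGenericSystem.tripleDet_ne_zero {ι : Type*} {L : ι → AffineSubspace F (F × F)}
    {d : ι → F × F} {γ : ι → F} (h : IsGenericSystem L d γ) {i j k : ι} (hij : i ≠ j)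
    (hjk : j ≠ k) (hik : i ≠ k) : tripleDet d γ i j k ≠ 0 := by
  obtain ⟨p, hi, hj⟩ := exists_cross_eq (h.cross_ne_zero i j hij) (γ i) (γ j)
  rw [← neg_ne_zero, ← sub_mul_cross_eq_neg_tripleDet hi hj]
  exact mul_ne_zero (sub_ne_zero.2 (h.not_concurrent i j k hij hjk hik p hi hj))
    (h.cross_ne_zero i j hij)

lemma cross_sub_smul (d P w : F × F) (t : F) :
    cross d (P - t • w) = cross d P - t * cross d w := by
  simp only [cross, Prod.fst_sub, Prod.snd_sub, Prod.smul_fst, Prod.smul_snd, smul_eq_mul]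
  ring

lemma cross_smul_right (d w : F × F) (t : F) : cross d (t • w) = t * cross d w := by
  simp only [cross, Prod.smul_fst, Prod.smul_snd, smul_eq_mul]
  ring

lemma cross_swap (u v : F × F) : cross u v = -cross v u := by
  simp only [cross]; ring

lemma mul_neg_iff_of_pos {a b : F} (hb : 0 < b) : a * b < 0 ↔ a < 0 := by
  simpa using mul_lt_mul_iff_left₀ hb (b := a) (c := 0)

lemma fin_four_cases {a b c e : Fin 4} (hab : a ≠ b) (hac : a ≠ c) (hae : a ≠ e) (hbc : b ≠ c)
    (hbe : b ≠ e) (hce : c ≠ e) (j : Fin 4) : j = a ∨ j = b ∨ j = c ∨ j = e := by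
  omega

section Nook

variable {Q : Fin 4 → AffineSubspace F (F × F)} {d : Fin 4 → F × F} {γ : Fin 4 → F}

/-- The inner coordinate on the line `a` of its intersection point `P` with `b` is `2` exactly if
`P` lies between the intersections with the other two lines `c` and `e`. -/
lemma IsGenericSystem.innerCoord_iff (h : IsGenericSystem Q d γ) {a b c e : Fin 4} (hab : a ≠ b)
    (hac : a ≠ c) (hae : a ≠ e) (hbc : b ≠ c) (hbe : b ≠ e) (hce : c ≠ e) {P : F × F}
    (ha : P ∈ Q a) (hb : P ∈ Q b) :
    (∀ x : ZMod 4, IsInnerCoord Q a P x → x ≠ 1 ∧ x ≠ -1) ↔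
      (cross (d c) P - γ c) * (cross (d e) P - γ e) *
        (cross (d a) (d c) * cross (d a) (d e)) < 0 := by
  have hpos : ∀ s : F, s ≠ 0 →
      (((position Q a (s • d a) P : ZMod 4) ≠ 1 ∧ (position Q a (s • d a) P : ZMod 4) ≠ -1) ↔
      (cross (d c) P - γ c) * (cross (d e) P - γ e) *
        (cross (d a) (d c) * cross (d a) (d e)) < 0) := by
    intro s hs
    have hw : ∀ j, a ≠ j → cross (d j) (s • d a) ≠ 0 := fun j hj => by
      rw [cross_smul_right]; exact mul_ne_zero hs (h.cross_ne_zero _ _ hj.symm)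
    -- The line `j` is met at the parameter `(cross (d j) P - γ j) / cross (d j) (s • d a)`.
    have hmeet : ∀ j, a ≠ j → ((∃ t : F, 0 ≤ t ∧ P - t • (s • d a) ∈ Q j) ↔
        0 ≤ (cross (d j) P - γ j) / cross (d j) (s • d a)) := by
      intro j hj
      constructor
      · rintro ⟨t, ht, hPt⟩
        rw [h.mem_iff, cross_sub_smul] at hPt
        rwa [show cross (d j) P - γ j = t * cross (d j) (s • d a) by linear_combination hPt,
          mul_div_cancel_right₀ _ (hw j hj)]
      · intro h0
        refine ⟨_, h0, ?_⟩
        rw [h.mem_iff, cross_sub_smul, div_mul_cancel₀ _ (hw j hj)]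
        ring
    rw [h.mem_iff] at ha hb
    set x := (cross (d c) P - γ c) / cross (d c) (s • d a) with hx
    set y := (cross (d e) P - γ e) / cross (d e) (s • d a) with hy
    have hx0 : x ≠ 0 := div_ne_zero
      (sub_ne_zero.2 (h.not_concurrent a b c hab hbc hac P ha hb)) (hw c hac)
    have hy0 : y ≠ 0 := div_ne_zero
      (sub_ne_zero.2 (h.not_concurrent a b e hab hbe hae P ha hb)) (hw e hae)
    have hprod : (cross (d c) P - γ c) * (cross (d e) P - γ e) *
        (cross (d a) (d c) * cross (d a) (d e)) =
        (x * y) * (s * cross (d a) (d c) * cross (d a) (d e)) ^ 2 := by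
      have h1 : cross (d c) P - γ c = x * (s * -cross (d a) (d c)) := by
        rw [← cross_swap, ← cross_smul_right, hx, div_mul_cancel₀ _ (hw c hac)]
      have h2 : cross (d e) P - γ e = y * (s * -cross (d a) (d e)) := by
        rw [← cross_swap, ← cross_smul_right, hy, div_mul_cancel₀ _ (hw e hae)]
      rw [h1, h2]; ring
    have hsq : 0 < (s * cross (d a) (d c) * cross (d a) (d e)) ^ 2 := by
      have h1 := h.cross_ne_zero a c hac
      have h2 := h.cross_ne_zero a e hae
      positivity
    rw [hprod, mul_neg_iff_of_pos hsq]
    have hcases := fin_four_cases hab hac hae hbc hbe hce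
    have hset : {j : Fin 4 | j ≠ a ∧ ∃ t : F, 0 ≤ t ∧ P - t • (s • d a) ∈ Q j} =
        {j | j = b ∨ (j = c ∧ 0 < x) ∨ (j = e ∧ 0 < y)} := by
      ext j
      simp only [Set.mem_ofPred_eq]
      rcases hcases j with rfl | rfl | rfl | rfl
      · simp [hab, hac, hae]
      · simp only [true_or, iff_true]
        refine ⟨hab.symm, (hmeet _ hab).2 ?_⟩
        rw [hb, sub_self, zero_div]
      · rw [hmeet _ hac, hx0.symm.le_iff_lt]
        simp [hac.symm, hbc.symm, hce]
      · rw [hmeet _ hae, hy0.symm.le_iff_lt]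
        simp [hae.symm, hbe.symm, hce.symm]
    unfold position
    rw [hset]
    rcases lt_or_gt_of_ne hx0 with h1 | h1 <;> rcases lt_or_gt_of_ne hy0 with h2 | h2
    · have : {j | j = b ∨ (j = c ∧ 0 < x) ∨ (j = e ∧ 0 < y)} = {b} := by
        ext j; simp [h1.not_gt, h2.not_gt]
      rw [this, Set.ncard_singleton]
      simp [(mul_pos_of_neg_of_neg h1 h2).le]
    · have : {j | j = b ∨ (j = c ∧ 0 < x) ∨ (j = e ∧ 0 < y)} = {b, e} := by
        ext j; simp [h1.not_gt, h2]
      rw [this, Set.ncard_pair hbe]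
      simp only [mul_neg_of_neg_of_pos h1 h2, iff_true]
      decide
    · have : {j | j = b ∨ (j = c ∧ 0 < x) ∨ (j = e ∧ 0 < y)} = {b, c} := by
        ext j; simp [h1, h2.not_gt]
      rw [this, Set.ncard_pair hbc]
      simp only [mul_neg_of_pos_of_neg h1 h2, iff_true]
      decide
    · have : {j | j = b ∨ (j = c ∧ 0 < x) ∨ (j = e ∧ 0 < y)} = {b, c, e} := by
        ext j; simp [h1, h2]
      rw [this, Set.ncard_eq_three.2 ⟨b, c, e, hbc, hbe, hce, rfl⟩]
      simp only [(mul_pos h1 h2).le.not_gt, iff_false]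
      decide
  constructor
  · intro hx
    refine (hpos 1 one_ne_zero).1 (hx _ ⟨_, ?_, ?_, rfl⟩)
    · rw [one_smul, h.mem_direction_iff, cross]; ring
    · rw [one_smul]; exact h.ne_zero a
  · rintro hneg x ⟨w, hw, hw0, rfl⟩
    obtain ⟨s, rfl⟩ := exists_eq_smul_of_cross_eq_zero (h.ne_zero a)
      ((h.mem_direction_iff a w).1 hw)
    exact (hpos s fun h0 => hw0 (by simp [h0])).2 hneg

lemma IsGenericSystem.isNookPoint_iff (h : IsGenericSystem Q d γ) {i j k l : Fin 4} (hij : i ≠ j)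
    (hik : i ≠ k) (hil : i ≠ l) (hjk : j ≠ k) (hjl : j ≠ l) (hkl : k ≠ l) {P : F × F}
    (hi : P ∈ Q i) (hj : P ∈ Q j) :
    IsNookPoint Q P ↔
      (cross (d k) P - γ k) * (cross (d l) P - γ l) *
        (cross (d i) (d k) * cross (d i) (d l)) < 0 ∧
      (cross (d k) P - γ k) * (cross (d l) P - γ l) *
        (cross (d j) (d k) * cross (d j) (d l)) < 0 := by
  rw [← h.innerCoord_iff hij hik hil hjk hjl hkl hi hj,
    ← h.innerCoord_iff hij.symm hjk hjl hik hil hkl hj hi]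
  constructor
  · exact fun hP => ⟨hP.2 i hi, hP.2 j hj⟩
  · rintro ⟨h1, h2⟩
    refine ⟨⟨i, j, hij, hi, hj⟩, fun r hr => ?_⟩
    have hcases := fin_four_cases hij hik hil hjk hjl hkl
    rcases hcases r with rfl | rfl | rfl | rfl
    · exact h1
    · exact h2
    · rw [h.mem_iff] at hi hj hr
      exact absurd hr (h.not_concurrent i j r hij hjk hik P hi hj)
    · rw [h.mem_iff] at hi hj hr
      exact absurd hr (h.not_concurrent i j r hij hjl hil P hi hj)

/-- Which intersection point is the nook point depends only on the orders of the slopes and on the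
orientations of the triangles. -/
lemma IsGenericSystem.isNookPoint_iff_tripleDet (h : IsGenericSystem Q d γ) {i j k l : Fin 4}
    (hij : i ≠ j) (hik : i ≠ k) (hil : i ≠ l) (hjk : j ≠ k) (hjl : j ≠ l) (hkl : k ≠ l)
    {P : F × F} (hi : P ∈ Q i) (hj : P ∈ Q j) :
    IsNookPoint Q P ↔
      tripleDet d γ i j k * tripleDet d γ i j l *
        (cross (d i) (d k) * cross (d i) (d l)) < 0 ∧
      tripleDet d γ i j k * tripleDet d γ i j l *
        (cross (d j) (d k) * cross (d j) (d l)) < 0 := by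
  rw [h.isNookPoint_iff hij hik hil hjk hjl hkl hi hj]
  rw [h.mem_iff] at hi hj
  have hprod : tripleDet d γ i j k * tripleDet d γ i j l =
      (cross (d k) P - γ k) * (cross (d l) P - γ l) * cross (d i) (d j) ^ 2 := by
    have h1 := neg_eq_iff_eq_neg.2 (sub_mul_cross_eq_neg_tripleDet (k := k) hi hj)
    have h2 := neg_eq_iff_eq_neg.2 (sub_mul_cross_eq_neg_tripleDet (k := l) hi hj)
    rw [← h1, ← h2]; ring
  have hsq : 0 < cross (d i) (d j) ^ 2 := by
    have := h.cross_ne_zero i j hij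
    positivity
  rw [hprod, mul_right_comm _ (_ ^ 2), mul_right_comm _ (_ ^ 2),
    mul_neg_iff_of_pos hsq, mul_neg_iff_of_pos hsq]

end Nook

/-! ### Nook points and piecewise linear maps -/

/-- The condition of `IsGenericSystem.innerCoord_iff` in terms of betweenness: `P` lies strictly
between the intersections of the line `a` with the lines `c` and `e`. -/
lemma IsGenericSystem.exists_sbtw_iff {ι : Type*} {Q : ι → AffineSubspace F (F × F)}
    {d : ι → F × F} {γ : ι → F} (h : IsGenericSystem Q d γ) {a c e : ι} (hac : a ≠ c)
    (hae : a ≠ e) {P : F × F} (ha : P ∈ Q a) :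
    (∃ X Y, (X ∈ Q a ∧ X ∈ Q c) ∧ (Y ∈ Q a ∧ Y ∈ Q e) ∧ Sbtw F X P Y) ↔
      (cross (d c) P - γ c) * (cross (d e) P - γ e) *
        (cross (d a) (d c) * cross (d a) (d e)) < 0 := by
  have hc0 := h.cross_ne_zero c a hac.symm
  have he0 := h.cross_ne_zero e a hae.symm
  rw [cross_swap (d a) (d c), cross_swap (d a) (d e)]
  simp only [h.mem_iff] at ha ⊢
  have hself : cross (d a) (d a) = 0 := by simp only [cross]; ring
  constructor
  · rintro ⟨X, Y, ⟨hXa, hXc⟩, ⟨hYa, hYe⟩, hs⟩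
    obtain ⟨⟨τ, ⟨hτ0, hτ1⟩, rfl⟩, hXY⟩ := sbtw_iff_mem_image_Ioo_and_ne.1 hs
    obtain ⟨r, hr⟩ := exists_eq_smul_of_cross_eq_zero (w := Y - X) (h.ne_zero a) (by
      simp only [cross, Prod.fst_sub, Prod.snd_sub] at hXa hYa ⊢
      linear_combination hYa - hXa)
    have hr0 : r ≠ 0 := by
      rintro rfl
      rw [zero_smul, sub_eq_zero] at hr
      exact hXY hr.symm
    have hP : AffineMap.lineMap X Y τ = X - (-(τ * r)) • d a := by
      rw [AffineMap.lineMap_apply, vsub_eq_sub, hr, vadd_eq_add, smul_smul, neg_smul]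
      abel
    have hP' : AffineMap.lineMap X Y τ = Y - ((1 - τ) * r) • d a := by
      rw [hP, ← sub_add_cancel Y X, hr]
      module
    have h1 : cross (d c) (AffineMap.lineMap X Y τ) - γ c = τ * r * cross (d c) (d a) := by
      rw [hP, cross_sub_smul, hXc]; ring
    have h2 : cross (d e) (AffineMap.lineMap X Y τ) - γ e =
        -((1 - τ) * r * cross (d e) (d a)) := by
      rw [hP', cross_sub_smul, hYe]; ring
    rw [h1, h2]
    have h3 : 0 < 1 - τ := sub_pos.2 hτ1
    have : 0 < τ * (1 - τ) * (r * cross (d c) (d a) * cross (d e) (d a)) ^ 2 := by positivity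
    linarith
  · intro hneg
    set x := (cross (d c) P - γ c) / cross (d c) (d a) with hx
    set y := (cross (d e) P - γ e) / cross (d e) (d a) with hy
    have h1 : cross (d c) P - γ c = x * cross (d c) (d a) := by rw [hx, div_mul_cancel₀ _ hc0]
    have h2 : cross (d e) P - γ e = y * cross (d e) (d a) := by rw [hy, div_mul_cancel₀ _ he0]
    have hxy : x * y < 0 := by
      rw [h1, h2] at hneg
      refine (mul_neg_iff_of_pos
        (show 0 < (cross (d c) (d a) * cross (d e) (d a)) ^ 2 by positivity)).1 ?_
      linarith
    have hne : x - y ≠ 0 := by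
      intro h0
      rw [sub_eq_zero.1 h0] at hxy
      exact absurd hxy (mul_self_nonneg y).not_gt
    refine ⟨P - x • d a, P - y • d a, ⟨?_, ?_⟩, ⟨?_, ?_⟩,
      sbtw_iff_mem_image_Ioo_and_ne.2 ⟨⟨x / (x - y), ?_, ?_⟩, ?_⟩⟩
    · rw [cross_sub_smul, hself, ha]; ring
    · rw [cross_sub_smul]; linear_combination h1
    · rw [cross_sub_smul, hself, ha]; ring
    · rw [cross_sub_smul]; linear_combination h2
    · rcases mul_neg_iff.1 hxy with ⟨h3, h4⟩ | ⟨h3, h4⟩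
      · exact ⟨div_pos h3 (by linarith), (div_lt_one (by linarith)).2 (by linarith)⟩
      · exact ⟨div_pos_of_neg_of_neg h3 (by linarith),
          (div_lt_one_of_neg (by linarith)).2 (by linarith)⟩
    · have hq : x / (x - y) * (x - y) = x := div_mul_cancel₀ _ hne
      rw [AffineMap.lineMap_apply, vsub_eq_sub, vadd_eq_add]
      have : P - y • d a - (P - x • d a) = (x - y) • d a := by module
      rw [this, smul_smul, hq]
      abel
    · intro h0
      have h3 : (x - y) • d a = 0 := by
        rw [sub_smul, sub_eq_zero]
        exact sub_right_injective h0
      exact (smul_ne_zero hne (h.ne_zero a)) h3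

/-- An injective piecewise linear map that sends the lines of one arrangement of four lines into
those of another maps the nook point to the nook point, since it preserves betweenness on the
lines. -/
lemma IsNookPoint.map {Q Q' : Fin 4 → AffineSubspace F (F × F)} {d d' : Fin 4 → F × F}
    {γ γ' : Fin 4 → F} (h : IsGenericSystem Q d γ) (h' : IsGenericSystem Q' d' γ')
    {f : F × F → F × F} (hf : IsPiecewiseLinear f) (hinj : Function.Injective f)
    (hQ : ∀ r, ∀ p ∈ Q r, f p ∈ Q' r) {P : F × F} (hP : IsNookPoint Q P) :
    IsNookPoint Q' (f P) := by
  obtain ⟨i, j, hij, hi, hj⟩ := hP.1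
  obtain ⟨k, l, hik, hil, hjk, hjl, hkl⟩ :
      ∃ k l : Fin 4, i ≠ k ∧ i ≠ l ∧ j ≠ k ∧ j ≠ l ∧ k ≠ l := by
    clear * - hij; revert i j; decide
  have hbtw : ∀ a c e, a ≠ c → a ≠ e → P ∈ Q a →
      (cross (d c) P - γ c) * (cross (d e) P - γ e) *
        (cross (d a) (d c) * cross (d a) (d e)) < 0 →
      (cross (d' c) (f P) - γ' c) * (cross (d' e) (f P) - γ' e) *
        (cross (d' a) (d' c) * cross (d' a) (d' e)) < 0 := by
    intro a c e hac hae ha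
    rw [← h.exists_sbtw_iff hac hae ha, ← h'.exists_sbtw_iff hac hae (hQ a P ha)]
    rintro ⟨X, Y, ⟨hXa, hXc⟩, ⟨hYa, hYe⟩, hs⟩
    refine ⟨f X, f Y, ⟨hQ _ _ hXa, hQ _ _ hXc⟩, ⟨hQ _ _ hYa, hQ _ _ hYe⟩,
      hf.sbtw hinj (h'.ne_zero a) (γ := γ' a) (fun t => ?_) hs⟩
    refine (h'.mem_iff _ _).1 (hQ a _ ?_)
    rw [h.mem_iff] at hXa hYa ⊢
    simp only [cross, Prod.fst_add, Prod.snd_add, Prod.smul_fst, Prod.smul_snd, Prod.fst_sub,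
      Prod.snd_sub, smul_eq_mul] at hXa hYa ⊢
    linear_combination (1 - t) * hXa + t * hYa
  rw [h.isNookPoint_iff hij hik hil hjk hjl hkl hi hj] at hP
  rw [h'.isNookPoint_iff hij hik hil hjk hjl hkl (hQ _ _ hi) (hQ _ _ hj)]
  exact ⟨hbtw i k l hik hil hi hP.1, hbtw j k l hjk hjl hj hP.2⟩

/-! ### Hyperplane arrangements with the same cells -/

section Conic

variable {V : Type*} [AddCommGroup V] [Module F V] {ι : Type*}

/-- The signs at `p` of the linear forms `ℓ i`: the cell of the arrangement of the hyperplanes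
`ℓ i = 0` that contains `p`. -/
def signVec (ℓ : ι → V →ₗ[F] F) (p : V) : ι → SignType := fun i => SignType.sign (ℓ i p)

/-- The cell with the signs `τ` is a face of the closure of the cell with the signs `σ`. -/
def IsFace (τ σ : ι → SignType) : Prop := ∀ i, τ i = 0 ∨ τ i = σ i

/-- A set of nonzero sign vectors, pairwise comparable in the face order, such that `u σ` is a
point of the cell `σ` for each of its members. -/
def IsFlag (ℓ : ι → V →ₗ[F] F) (u : (ι → SignType) → V) (c : Finset (ι → SignType)) : Prop :=
  (∀ σ ∈ c, σ ≠ 0 ∧ signVec ℓ (u σ) = σ) ∧ ∀ σ ∈ c, ∀ τ ∈ c, IsFace σ τ ∨ IsFace τ σ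

variable {ℓ ℓ' : ι → V →ₗ[F] F} {u u' : (ι → SignType) → V}

lemma IsFace.trans {ρ τ σ : ι → SignType} (h1 : IsFace ρ τ) (h2 : IsFace τ σ) : IsFace ρ σ := by
  intro i
  rcases h1 i with h | h
  · exact .inl h
  · rw [h]; exact h2 i

lemma IsFlag.subset {c c' : Finset (ι → SignType)} (h : IsFlag ℓ u c) (hc : c' ⊆ c) :
    IsFlag ℓ u c' :=
  ⟨fun σ hσ => h.1 σ (hc hσ), fun σ hσ τ hτ => h.2 σ (hc hσ) τ (hc hτ)⟩

lemma apply_eq_zero_of_signVec {p : V} {σ : ι → SignType} (h : signVec ℓ p = σ) {i : ι}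
    (hi : σ i = 0) : ℓ i p = 0 := by
  rw [← h] at hi
  exact sign_eq_zero_iff.1 hi

lemma apply_ne_zero_of_signVec {p : V} {σ : ι → SignType} (h : signVec ℓ p = σ) {i : ι}
    (hi : σ i ≠ 0) : ℓ i p ≠ 0 := by
  rw [← h] at hi
  exact sign_ne_zero.1 hi

variable [Fintype ι]

lemma IsFlag.exists_isFace {c : Finset (ι → SignType)} (h : IsFlag ℓ u c) (hne : c.Nonempty) :
    ∃ σ ∈ c, ∀ τ ∈ c, IsFace τ σ := by
  classical
  obtain ⟨σ, hσ, hmax⟩ := Finset.exists_max_image c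
    (fun σ => (Finset.univ.filter fun i => σ i ≠ 0).card) hne
  refine ⟨σ, hσ, fun τ hτ => ?_⟩
  rcases h.2 τ hτ σ hσ with h1 | h1
  · exact h1
  · have hsub : (Finset.univ.filter fun i => σ i ≠ 0) ⊆ Finset.univ.filter fun i => τ i ≠ 0 := by
      intro i hi
      simp only [Finset.mem_filter, Finset.mem_univ, true_and] at hi ⊢
      rwa [← (h1 i).resolve_left hi]
    have heq := Finset.eq_of_subset_of_card_le hsub (hmax τ hτ)
    intro i
    by_cases hi : τ i = 0
    · exact .inl hi
    · have : i ∈ Finset.univ.filter fun i => σ i ≠ 0 := by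
        rw [heq]; simpa using hi
      simp only [Finset.mem_filter, Finset.mem_univ, true_and] at this
      exact .inr ((h1 i).resolve_left this).symm

/-- A nonempty flag has a largest member, and some form vanishes on all the other cells of the flag
but not on this one. -/
lemma IsFlag.exists_top {c : Finset (ι → SignType)} (h : IsFlag ℓ u c) (hne : c.Nonempty) :
    ∃ σ ∈ c, (∀ τ ∈ c, IsFace τ σ) ∧ ∃ i, σ i ≠ 0 ∧ ∀ τ ∈ c.erase σ, τ i = 0 := by
  classical
  obtain ⟨σ, hσ, htop⟩ := h.exists_isFace hne
  refine ⟨σ, hσ, htop, ?_⟩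
  rcases (c.erase σ).eq_empty_or_nonempty with h0 | h0
  · obtain ⟨i, hi⟩ := Function.ne_iff.1 (h.1 σ hσ).1
    exact ⟨i, hi, by simp [h0]⟩
  · obtain ⟨τ, hτ, htop'⟩ := (h.subset (c.erase_subset σ)).exists_isFace h0
    obtain ⟨hτσ, hτc⟩ := Finset.mem_erase.1 hτ
    obtain ⟨i, hi⟩ := Function.ne_iff.1 hτσ
    have hi0 : τ i = 0 := (htop τ hτc i).resolve_right hi
    refine ⟨i, fun hs => hi (by rw [hi0, hs]), fun ρ hρ => ?_⟩
    rcases htop' ρ hρ i with h1 | h1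
    · exact h1
    · rw [h1, hi0]

lemma IsFlag.apply_sum_erase_eq_zero {c : Finset (ι → SignType)} (h : IsFlag ℓ u c)
    (w : (ι → SignType) → F) {σ : ι → SignType} {i : ι} (hi : ∀ τ ∈ c.erase σ, τ i = 0) :
    ℓ i (∑ τ ∈ c.erase σ, w τ • u τ) = 0 := by
  rw [map_sum]
  refine Finset.sum_eq_zero fun τ hτ => ?_
  rw [map_smul, apply_eq_zero_of_signVec (h.1 τ (Finset.mem_of_mem_erase hτ)).2 (hi τ hτ),
    smul_zero]

/-- A positive combination of the points of a flag lies in the largest cell of the flag. -/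
lemma IsFlag.signVec_sum {c : Finset (ι → SignType)} (h : IsFlag ℓ u c)
    {w : (ι → SignType) → F} (hw : ∀ σ ∈ c, 0 < w σ) {σ : ι → SignType} (hσ : σ ∈ c)
    (htop : ∀ τ ∈ c, IsFace τ σ) : signVec ℓ (∑ τ ∈ c, w τ • u τ) = σ := by
  funext i
  simp only [signVec, map_sum, map_smul, smul_eq_mul]
  have hval : ∀ τ ∈ c, SignType.sign (ℓ i (u τ)) = 0 ∨ SignType.sign (ℓ i (u τ)) = σ i := by
    intro τ hτ
    have : SignType.sign (ℓ i (u τ)) = τ i := congrFun (h.1 τ hτ).2 i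
    rw [this]; exact htop τ hτ i
  have hσi : SignType.sign (ℓ i (u σ)) = σ i := congrFun (h.1 σ hσ).2 i
  rcases hs : σ i with _ | _ | _
  · rw [hs] at hσi hval
    rw [SignType.zero_eq_zero, sign_eq_zero_iff]
    refine Finset.sum_eq_zero fun τ hτ => ?_
    have h0 : SignType.sign (ℓ i (u τ)) = 0 := (hval τ hτ).elim id id
    rw [sign_eq_zero_iff.1 h0, mul_zero]
  · rw [hs] at hσi hval
    rw [SignType.neg_eq_neg_one, sign_eq_neg_one_iff] at *
    refine Finset.sum_neg' (fun τ hτ => ?_) ⟨σ, hσ, mul_neg_of_pos_of_neg (hw σ hσ) hσi⟩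
    refine mul_nonpos_of_nonneg_of_nonpos (hw τ hτ).le ?_
    rcases hval τ hτ with h1 | h1
    · exact (sign_eq_zero_iff.1 h1).le
    · exact (sign_eq_neg_one_iff.1 h1).le
  · rw [hs] at hσi hval
    rw [SignType.pos_eq_one, sign_eq_one_iff] at *
    refine Finset.sum_pos' (fun τ hτ => ?_) ⟨σ, hσ, mul_pos (hw σ hσ) hσi⟩
    refine mul_nonneg (hw τ hτ).le ?_
    rcases hval τ hτ with h1 | h1
    · exact (sign_eq_zero_iff.1 h1).ge
    · exact (sign_eq_one_iff.1 h1).le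

/-- Every point is a positive combination of the points of a flag. One subtracts from `p` the
largest multiple of the point `u σ` of its cell `σ` that leaves a point of the closed cell; the
remainder lies in a smaller face. -/
lemma exists_flag (hess : ∀ p, (∀ i, ℓ i p = 0) → p = 0)
    (hu : ∀ p, signVec ℓ (u (signVec ℓ p)) = signVec ℓ p) (p : V) :
    ∃ (c : Finset (ι → SignType)) (w : (ι → SignType) → F), IsFlag ℓ u c ∧ (∀ σ ∈ c, 0 < w σ) ∧
      (∀ σ ∈ c, IsFace σ (signVec ℓ p)) ∧ ∑ σ ∈ c, w σ • u σ = p := by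
  classical
  induction hk : (Finset.univ.filter fun i => ℓ i p ≠ 0).card using Nat.strong_induction_on
    generalizing p with
  | _ k ih =>
  by_cases hp : ∀ i, ℓ i p = 0
  · refine ⟨∅, 0, ⟨by simp, by simp⟩, by simp, by simp, ?_⟩
    rw [hess p hp, Finset.sum_empty]
  push Not at hp
  set σ := signVec ℓ p with hσ
  have huσ := hu p
  rw [← hσ] at huσ
  have hratio : ∀ i, ℓ i p ≠ 0 → 0 < ℓ i p / ℓ i (u σ) := by
    intro i hi
    have hs : SignType.sign (ℓ i (u σ)) = SignType.sign (ℓ i p) := congrFun huσ i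
    rcases lt_or_gt_of_ne hi with h1 | h1
    · rw [sign_neg h1, sign_eq_neg_one_iff] at hs
      exact div_pos_of_neg_of_neg h1 hs
    · rw [sign_pos h1, sign_eq_one_iff] at hs
      exact div_pos h1 hs
  obtain ⟨i₀, hi₀, hmin⟩ := Finset.exists_min_image (Finset.univ.filter fun i => ℓ i p ≠ 0)
    (fun i => ℓ i p / ℓ i (u σ)) (hp.imp fun i hi => by simpa using hi)
  simp only [Finset.mem_filter, Finset.mem_univ, true_and] at hi₀ hmin
  set lam := ℓ i₀ p / ℓ i₀ (u σ) with hlam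
  have hlam0 : 0 < lam := hratio i₀ hi₀
  set r := p - lam • u σ with hr
  have hu0 : ∀ i, ℓ i p ≠ 0 → ℓ i (u σ) ≠ 0 := fun i hi h0 => by
    have := hratio i hi; rw [h0, div_zero] at this; exact this.false
  have hr0 : ∀ i, ℓ i p = 0 → ℓ i r = 0 := by
    intro i hi
    have hs : SignType.sign (ℓ i (u σ)) = SignType.sign (ℓ i p) := congrFun huσ i
    rw [hi, sign_zero, sign_eq_zero_iff] at hs
    rw [hr, map_sub, map_smul, hs, hi, smul_zero, sub_zero]
  have hrmul : ∀ i, ℓ i p ≠ 0 → ℓ i r = ℓ i (u σ) * (ℓ i p / ℓ i (u σ) - lam) := by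
    intro i hi
    rw [hr, map_sub, map_smul, smul_eq_mul, mul_sub, mul_div_cancel₀ _ (hu0 i hi), mul_comm lam]
  have hri₀ : ℓ i₀ r = 0 := by rw [hrmul i₀ hi₀, ← hlam, sub_self, mul_zero]
  have hface : IsFace (signVec ℓ r) σ := by
    intro i
    by_cases hi : ℓ i p = 0
    · left; rw [signVec, hr0 i hi, sign_zero]
    · have hs : SignType.sign (ℓ i (u σ)) = σ i := congrFun huσ i
      rcases (hmin i hi).eq_or_lt with h1 | h1
      · left; rw [signVec, hrmul i hi, ← h1, sub_self, mul_zero, sign_zero]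
      · right
        rw [signVec, hrmul i hi, sign_mul, sign_pos (sub_pos.2 h1), mul_one, hs]
  have hlt : (Finset.univ.filter fun i => ℓ i r ≠ 0).card < k := by
    rw [← hk]
    refine Finset.card_lt_card ((Finset.ssubset_iff_of_subset fun i hi => ?_).2 ⟨i₀, ?_, ?_⟩)
    · simp only [Finset.mem_filter, Finset.mem_univ, true_and] at hi ⊢
      exact fun h0 => hi (hr0 i h0)
    · simpa using hi₀
    · simpa using hri₀
  obtain ⟨c, w, hc, hw, hcf, hsum⟩ := ih _ hlt r rfl
  have hσc : σ ∉ c := by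
    intro h
    have := hcf σ h i₀
    simp only [signVec, hri₀, sign_zero, or_self, hσ] at this
    exact hi₀ (sign_eq_zero_iff.1 this)
  have hface' : ∀ τ ∈ c, IsFace τ σ := fun τ hτ => (hcf τ hτ).trans hface
  have hself : IsFace σ σ := fun i => .inr rfl
  refine ⟨insert σ c, Function.update w σ lam, ⟨?_, ?_⟩, ?_, ?_, ?_⟩
  · intro τ hτ
    rcases Finset.mem_insert.1 hτ with rfl | hτ
    · refine ⟨fun h0 => hi₀ ?_, huσ⟩
      exact apply_eq_zero_of_signVec hσ.symm (congrFun h0 i₀)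
    · exact hc.1 τ hτ
  · intro τ hτ ρ hρ
    rcases Finset.mem_insert.1 hτ with rfl | hτ <;> rcases Finset.mem_insert.1 hρ with rfl | hρ
    · exact .inl hself
    · exact .inr (hface' ρ hρ)
    · exact .inl (hface' τ hτ)
    · exact hc.2 τ hτ ρ hρ
  · intro τ hτ
    rcases Finset.mem_insert.1 hτ with rfl | hτ
    · simpa using hlam0
    · rw [Function.update_of_ne (ne_of_mem_of_not_mem hτ hσc)]; exact hw τ hτ
  · intro τ hτ
    rcases Finset.mem_insert.1 hτ with rfl | hτ
    · exact hself
    · exact hface' τ hτ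
  · rw [Finset.sum_insert hσc, Function.update_self]
    have : ∑ τ ∈ c, Function.update w σ lam τ • u τ = r := by
      rw [← hsum]
      refine Finset.sum_congr rfl fun τ hτ => ?_
      rw [Function.update_of_ne (ne_of_mem_of_not_mem hτ hσc)]
    rw [this, hr]; abel

/-- A positive combination of the points of a flag determines the flag and its coefficients, hence
also the combination of other vectors `v σ` with these coefficients. -/
lemma IsFlag.sum_eq_sum {c₁ c₂ : Finset (ι → SignType)} (h₁ : IsFlag ℓ u c₁)
    (h₂ : IsFlag ℓ u c₂) {w₁ w₂ : (ι → SignType) → F} (hw₁ : ∀ σ ∈ c₁, 0 < w₁ σ)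
    (hw₂ : ∀ σ ∈ c₂, 0 < w₂ σ) (heq : ∑ σ ∈ c₁, w₁ σ • u σ = ∑ σ ∈ c₂, w₂ σ • u σ)
    (v : (ι → SignType) → V) : ∑ σ ∈ c₁, w₁ σ • v σ = ∑ σ ∈ c₂, w₂ σ • v σ := by
  classical
  induction c₁ using Finset.strongInduction generalizing c₂ with
  | _ c₁ ih =>
  have hzero : signVec ℓ (0 : V) = 0 := by funext i; simp [signVec]
  rcases c₁.eq_empty_or_nonempty with rfl | hne₁
  · rcases c₂.eq_empty_or_nonempty with rfl | hne₂
    · rfl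
    · obtain ⟨σ, hσ, htop, -⟩ := h₂.exists_top hne₂
      have := h₂.signVec_sum hw₂ hσ htop
      rw [← heq, Finset.sum_empty, hzero] at this
      exact absurd this.symm (h₂.1 σ hσ).1
  rcases c₂.eq_empty_or_nonempty with rfl | hne₂
  · obtain ⟨σ, hσ, htop, -⟩ := h₁.exists_top hne₁
    have := h₁.signVec_sum hw₁ hσ htop
    rw [heq, Finset.sum_empty, hzero] at this
    exact absurd this.symm (h₁.1 σ hσ).1
  obtain ⟨σ, hσ₁, htop₁, i₁, hi₁, hz₁⟩ := h₁.exists_top hne₁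
  obtain ⟨σ', hσ₂, htop₂, i₂, hi₂, hz₂⟩ := h₂.exists_top hne₂
  have hs₁ := h₁.signVec_sum hw₁ hσ₁ htop₁
  have hs₂ := h₂.signVec_sum hw₂ hσ₂ htop₂
  obtain rfl : σ = σ' := by rw [← hs₁, ← hs₂, heq]
  set p₁ := ∑ τ ∈ c₁.erase σ, w₁ τ • u τ with hp₁
  set p₂ := ∑ τ ∈ c₂.erase σ, w₂ τ • u τ with hp₂
  have he₁ := Finset.add_sum_erase c₁ (fun τ => w₁ τ • u τ) hσ₁
  have he₂ := Finset.add_sum_erase c₂ (fun τ => w₂ τ • u τ) hσ₂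
  have he₁' := Finset.add_sum_erase c₁ (fun τ => w₁ τ • v τ) hσ₁
  have he₂' := Finset.add_sum_erase c₂ (fun τ => w₂ τ • v τ) hσ₂
  have hE₁ := h₁.subset (c₁.erase_subset σ)
  have hE₂ := h₂.subset (c₂.erase_subset σ)
  -- If the coefficients of `σ` differed, subtracting the smaller multiple of `u σ` would give a
  -- point of the cell `σ` on one side and a point of a proper face on the other.
  have haux : ∀ (c : Finset (ι → SignType)) (w w' : (ι → SignType) → F) (q : V) (i : ι),
      IsFlag ℓ u c → (∀ τ ∈ c, 0 < w τ) → (∀ τ ∈ c, IsFace τ σ) → σ ∈ c → σ i ≠ 0 →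
      ℓ i q = 0 → ∑ τ ∈ c, w τ • u τ = w' σ • u σ + q → w σ ≤ w' σ := by
    intro c w w' q i hc hw htop hσ hi hq hsum
    by_contra hlt
    rw [not_le] at hlt
    have hsig := hc.signVec_sum (w := Function.update w σ (w σ - w' σ))
      (fun τ hτ => by
        by_cases h : τ = σ
        · subst h; simpa using hlt
        · rw [Function.update_of_ne h]; exact hw τ hτ) hσ htop
    refine apply_ne_zero_of_signVec hsig hi ?_
    rw [← Finset.add_sum_erase c _ hσ, Function.update_self]
    have h1 : ∑ τ ∈ c.erase σ, Function.update w σ (w σ - w' σ) τ • u τ =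
        ∑ τ ∈ c.erase σ, w τ • u τ :=
      Finset.sum_congr rfl fun τ hτ => by rw [Function.update_of_ne (Finset.ne_of_mem_erase hτ)]
    rw [← Finset.add_sum_erase c _ hσ] at hsum
    rw [h1, sub_smul, show w σ • u σ - w' σ • u σ + ∑ τ ∈ c.erase σ, w τ • u τ = q by
      rw [sub_add_eq_add_sub, hsum, add_sub_cancel_left], hq]
  have hw12 : w₁ σ = w₂ σ := by
    apply le_antisymm
    · exact haux c₁ w₁ w₂ p₂ i₂ h₁ hw₁ htop₁ hσ₁ hi₂ (h₂.apply_sum_erase_eq_zero w₂ hz₂)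
        (heq.trans he₂.symm)
    · exact haux c₂ w₂ w₁ p₁ i₁ h₂ hw₂ htop₂ hσ₂ hi₁ (h₁.apply_sum_erase_eq_zero w₁ hz₁)
        (heq.symm.trans he₁.symm)
  rw [← he₁', ← he₂', hw12]
  congr 1
  refine ih _ (Finset.erase_ssubset hσ₁) hE₁ hE₂
    (fun τ hτ => hw₁ τ (Finset.mem_of_mem_erase hτ))
    (fun τ hτ => hw₂ τ (Finset.mem_of_mem_erase hτ)) ?_
  rw [← he₁, ← he₂, hw12] at heq
  exact add_left_cancel heq

lemma IsFlag.eq_zero_of_sum_eq_zero {c : Finset (ι → SignType)} (h : IsFlag ℓ u c)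
    {w : (ι → SignType) → F} (hsum : ∑ σ ∈ c, w σ • u σ = 0) : ∀ σ ∈ c, w σ = 0 := by
  classical
  induction c using Finset.strongInduction with
  | _ c ih =>
  rcases c.eq_empty_or_nonempty with rfl | hne
  · simp
  obtain ⟨σ, hσ, -, i, hi, hz⟩ := h.exists_top hne
  rw [← Finset.add_sum_erase c _ hσ] at hsum
  have h0 : w σ = 0 := by
    have := congrArg (ℓ i) hsum
    rw [map_add, h.apply_sum_erase_eq_zero w hz, map_smul, map_zero, add_zero, smul_eq_mul] at this
    exact (mul_eq_zero.1 this).resolve_right (apply_ne_zero_of_signVec (h.1 σ hσ).2 hi)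
  rw [h0, zero_smul, zero_add] at hsum
  intro τ hτ
  by_cases hτσ : τ = σ
  · rw [hτσ, h0]
  · exact ih _ (Finset.erase_ssubset hσ) (h.subset (c.erase_subset σ)) hsum τ
      (Finset.mem_erase.2 ⟨hτσ, hτ⟩)

/-- A map of a vector space is conically piecewise linear if the space is a finite union of
polyhedral cones on each of which the map is linear. -/
def IsConicallyPiecewiseLinear (f : V → V) : Prop :=
  ∃ 𝒦 : Set (Set V), 𝒦.Finite ∧ ⋃₀ 𝒦 = Set.univ ∧
    ∀ K ∈ 𝒦, (∃ s : Finset (V →ₗ[F] F), K = {p | ∀ h ∈ s, h p ≤ 0}) ∧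
      ∃ g : V →ₗ[F] V, Set.EqOn f g K

/-- The cone generated by linearly independent vectors is polyhedral, and any assignment of images
to the generators extends to a linear map. -/
lemma exists_polyhedral_cone [Module.Finite F V] {κ : Type*} [Fintype κ] (U U' : (κ → F) →ₗ[F] V)
    (hU : Function.Injective U) :
    (∃ s : Finset (V →ₗ[F] F), {p | ∃ w, (∀ k, 0 ≤ w k) ∧ U w = p} = {p | ∀ h ∈ s, h p ≤ 0}) ∧
      ∃ g : V →ₗ[F] V, ∀ w, g (U w) = U' w := by
  classical
  obtain ⟨H, hH⟩ := LinearMap.exists_leftInverse_of_injective U (LinearMap.ker_eq_bot.2 hU)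
  have hH' : ∀ w, H (U w) = w := fun w => LinearMap.congr_fun hH w
  refine ⟨⟨Finset.univ.image (fun k => -(LinearMap.proj k ∘ₗ H)) ∪
    (Finset.univ.image (fun m => (Module.finBasis F V).coord m ∘ₗ (LinearMap.id - U ∘ₗ H)) ∪
      Finset.univ.image fun m => -((Module.finBasis F V).coord m ∘ₗ (LinearMap.id - U ∘ₗ H))),
      ?_⟩, U' ∘ₗ H, fun w => by simp [hH']⟩
  ext p
  simp only [Set.mem_ofPred_eq, Finset.forall_mem_union, Finset.forall_mem_image,
    Finset.mem_univ, forall_const, LinearMap.neg_apply, LinearMap.comp_apply, LinearMap.proj_apply,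
    neg_nonpos]
  constructor
  · rintro ⟨w, hw, rfl⟩
    simp [hH', hw]
  · rintro ⟨h1, h2, h3⟩
    refine ⟨H p, h1, ?_⟩
    have : (LinearMap.id - U ∘ₗ H : V →ₗ[F] V) p = 0 := by
      refine (Module.finBasis F V).ext_elem fun m => ?_
      rw [map_zero]
      exact le_antisymm (@h2 m) (@h3 m)
    exact (sub_eq_zero.1 this).symm

/-- The map that sends `∑ w σ • u σ` to `∑ w σ • u' σ`, for the nonnegative combinations along
flags, is conically piecewise linear. -/
lemma isConicallyPiecewiseLinear_of_flag [Module.Finite F V]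
    (hess : ∀ p, (∀ i, ℓ i p = 0) → p = 0)
    (hu : ∀ p, signVec ℓ (u (signVec ℓ p)) = signVec ℓ p) {f : V → V}
    (hf : ∀ (c : Finset (ι → SignType)) (w : (ι → SignType) → F), IsFlag ℓ u c → (∀ σ ∈ c, 0 < w σ) →
      f (∑ σ ∈ c, w σ • u σ) = ∑ σ ∈ c, w σ • u' σ) :
    IsConicallyPiecewiseLinear (F := F) f := by
  classical
  let U : (c : Finset (ι → SignType)) → (c → F) →ₗ[F] V := fun c =>
    Fintype.linearCombination F fun σ : c => u σ
  let U' : (c : Finset (ι → SignType)) → (c → F) →ₗ[F] V := fun c =>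
    Fintype.linearCombination F fun σ : c => u' σ
  have hinj : ∀ c, IsFlag ℓ u c → Function.Injective (U c) := by
    intro c hc
    rw [← LinearMap.ker_eq_bot, LinearMap.ker_eq_bot']
    intro w hw
    have h0 : ∑ σ ∈ c, (fun σ => if h : σ ∈ c then w ⟨σ, h⟩ else 0) σ • u σ = 0 := by
      rw [← hw, ← Finset.sum_coe_sort]
      simp [U, Fintype.linearCombination_apply]
    funext σ
    have := hc.eq_zero_of_sum_eq_zero h0 σ σ.2
    simpa using this
  refine ⟨(fun c => {p | ∃ w, (∀ k, 0 ≤ w k) ∧ U c w = p}) '' {c | IsFlag ℓ u c},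
    (Set.toFinite _).image _, Set.eq_univ_of_forall fun p => ?_, ?_⟩
  · obtain ⟨c, w, hc, hw, -, hsum⟩ := exists_flag hess hu p
    refine ⟨_, ⟨c, hc, rfl⟩, fun σ => w σ, fun σ => (hw σ σ.2).le, ?_⟩
    rw [← hsum, ← Finset.sum_coe_sort]
    simp [U, Fintype.linearCombination_apply]
  · rintro _ ⟨c, hc, rfl⟩
    obtain ⟨h1, g, hg⟩ := exists_polyhedral_cone (U c) (U' c) (hinj c hc)
    refine ⟨h1, g, ?_⟩
    rintro _ ⟨w, hw, rfl⟩
    rw [hg]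
    -- The generators with coefficient zero are dropped from the flag.
    let W : (ι → SignType) → F := fun σ => if h : σ ∈ c then w ⟨σ, h⟩ else 0
    have hW : ∀ v : (ι → SignType) → V,
        Fintype.linearCombination F (fun σ : c => v σ) w =
          ∑ σ ∈ c.filter fun σ => 0 < W σ, W σ • v σ := by
      intro v
      rw [Finset.sum_filter_of_ne, ← Finset.sum_coe_sort]
      · simp [W, Fintype.linearCombination_apply]
      · intro σ hσ hne
        have h0 : 0 ≤ W σ := by simp [W, hσ, hw]
        exact lt_of_le_of_ne h0 fun h => hne (by rw [← h, zero_smul])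
    change f (Fintype.linearCombination F (fun σ : c => u σ) w) =
      Fintype.linearCombination F (fun σ : c => u' σ) w
    rw [hW, hW]
    exact hf _ _ (hc.subset (Finset.filter_subset _ _)) fun σ hσ => (Finset.mem_filter.1 hσ).2

/-- Two essential hyperplane arrangements with the same cells (that is, the same sign vectors) are
related by a conically piecewise linear bijection that maps each cell to the corresponding one.
It can be chosen to preserve the value of one of the forms. -/
theorem exists_conic_equiv [Module.Finite F V]
    (hess : ∀ p, (∀ i, ℓ i p = 0) → p = 0) (hess' : ∀ p, (∀ i, ℓ' i p = 0) → p = 0)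
    (hcov : ∀ p, ∃ p', signVec ℓ' p' = signVec ℓ p)
    (hcov' : ∀ p', ∃ p, signVec ℓ p = signVec ℓ' p') (i₀ : ι) :
    ∃ e : V ≃ V, IsConicallyPiecewiseLinear (F := F) e ∧
      IsConicallyPiecewiseLinear (F := F) e.symm ∧
      (∀ p, signVec ℓ' (e p) = signVec ℓ p) ∧ ∀ p, ℓ' i₀ (e p) = ℓ i₀ p := by
  classical
  have hrep : ∀ σ : ι → SignType, ∃ a b : V, ((∃ p, signVec ℓ p = σ) →
      signVec ℓ a = σ ∧ signVec ℓ' b = σ ∧ ℓ' i₀ b = ℓ i₀ a) := by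
    intro σ
    by_cases h : ∃ p, signVec ℓ p = σ
    · obtain ⟨a, rfl⟩ := h
      obtain ⟨b, hb⟩ := hcov a
      have hsgn : SignType.sign (ℓ' i₀ b) = SignType.sign (ℓ i₀ a) := congrFun hb i₀
      by_cases h0 : ℓ i₀ a = 0
      · refine ⟨a, b, fun _ => ⟨rfl, hb, ?_⟩⟩
        rw [h0, sign_zero, sign_eq_zero_iff] at hsgn
        rw [h0, hsgn]
      · -- Rescaling `b` makes the values of the distinguished form agree.
        have hb0 : ℓ' i₀ b ≠ 0 := by
          rw [← sign_ne_zero, hsgn]; exact sign_ne_zero.2 h0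
        have hpos : 0 < ℓ i₀ a / ℓ' i₀ b := by
          rcases lt_or_gt_of_ne h0 with h1 | h1
          · rw [sign_neg h1, sign_eq_neg_one_iff] at hsgn
            exact div_pos_of_neg_of_neg h1 hsgn
          · rw [sign_pos h1, sign_eq_one_iff] at hsgn
            exact div_pos h1 hsgn
        refine ⟨a, (ℓ i₀ a / ℓ' i₀ b) • b, fun _ => ⟨rfl, ?_, ?_⟩⟩
        · rw [← hb]
          funext i
          simp only [signVec, map_smul, smul_eq_mul, sign_mul, sign_pos hpos, one_mul]
        · rw [map_smul, smul_eq_mul, div_mul_cancel₀ _ hb0]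
    · exact ⟨0, 0, fun h' => (h h').elim⟩
  choose u u' huu using hrep
  have hu : ∀ p, signVec ℓ (u (signVec ℓ p)) = signVec ℓ p := fun p => (huu _ ⟨p, rfl⟩).1
  have hu' : ∀ p, signVec ℓ' (u' (signVec ℓ' p)) = signVec ℓ' p := fun p =>
    (huu _ (hcov' p)).2.1
  have hflag : ∀ c, IsFlag ℓ u c ↔ IsFlag ℓ' u' c := by
    intro c
    refine ⟨fun h => ⟨fun σ hσ => ⟨(h.1 σ hσ).1, ?_⟩, h.2⟩,
      fun h => ⟨fun σ hσ => ⟨(h.1 σ hσ).1, ?_⟩, h.2⟩⟩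
    · exact (huu σ ⟨_, (h.1 σ hσ).2⟩).2.1
    · obtain ⟨q, hq⟩ := hcov' (u' σ)
      exact (huu σ ⟨q, hq.trans (h.1 σ hσ).2⟩).1
  choose C W hC hW hCf hsum using exists_flag hess hu
  choose C' W' hC' hW' hCf' hsum' using exists_flag hess' hu'
  have hf : ∀ (c : Finset (ι → SignType)) (w : (ι → SignType) → F), IsFlag ℓ u c → (∀ σ ∈ c, 0 < w σ) →
      (fun p => ∑ σ ∈ C p, W p σ • u' σ) (∑ σ ∈ c, w σ • u σ) = ∑ σ ∈ c, w σ • u' σ :=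
    fun c w hc hw => (hC _).sum_eq_sum hc (hW _) hw (hsum _) u'
  have hf' : ∀ (c : Finset (ι → SignType)) (w : (ι → SignType) → F), IsFlag ℓ' u' c → (∀ σ ∈ c, 0 < w σ) →
      (fun p => ∑ σ ∈ C' p, W' p σ • u σ) (∑ σ ∈ c, w σ • u' σ) = ∑ σ ∈ c, w σ • u σ :=
    fun c w hc hw => (hC' _).sum_eq_sum hc (hW' _) hw (hsum' _) u
  refine ⟨⟨fun p => ∑ σ ∈ C p, W p σ • u' σ, fun p => ∑ σ ∈ C' p, W' p σ • u σ, fun p => ?_,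
    fun p => ?_⟩, isConicallyPiecewiseLinear_of_flag hess hu hf,
    isConicallyPiecewiseLinear_of_flag hess' hu' hf', fun p => ?_, fun p => ?_⟩
  · exact (hf' _ _ ((hflag _).1 (hC p)) (hW p)).trans (hsum p)
  · exact (hf _ _ ((hflag _).2 (hC' p)) (hW' p)).trans (hsum' p)
  · change signVec ℓ' (∑ σ ∈ C p, W p σ • u' σ) = signVec ℓ p
    rcases (C p).eq_empty_or_nonempty with h0 | hne
    · have hp : p = 0 := by rw [← hsum p, h0, Finset.sum_empty]
      rw [h0, hp, Finset.sum_empty]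
      funext i; simp [signVec]
    · obtain ⟨σ, hσ, htop, -⟩ := (hC p).exists_top hne
      rw [((hflag _).1 (hC p)).signVec_sum (hW p) hσ htop, ← (hC p).signVec_sum (hW p) hσ htop,
        hsum]
  · change ℓ' i₀ (∑ σ ∈ C p, W p σ • u' σ) = ℓ i₀ p
    conv_rhs => rw [← hsum p]
    simp only [map_sum, map_smul]
    refine Finset.sum_congr rfl fun σ hσ => ?_
    rw [(huu σ ⟨_, ((hC p).1 σ hσ).2⟩).2.2]

end Conic

/-! ### Arrangements with the same orientations of triangles -/

/-- The linear form on `F × F × F` with the coefficients `a`. -/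
def dotForm (a : F × F × F) : F × F × F →ₗ[F] F :=
  a.1 • LinearMap.fst F F (F × F) + a.2.1 • (LinearMap.fst F F F ∘ₗ LinearMap.snd F F (F × F)) +
    a.2.2 • (LinearMap.snd F F F ∘ₗ LinearMap.snd F F (F × F))

lemma dotForm_apply (a p : F × F × F) :
    dotForm a p = a.1 * p.1 + a.2.1 * p.2.1 + a.2.2 * p.2.2 := by
  simp [dotForm]

/-- The determinant of three vectors of `F × F × F`. -/
def det₃ (a b c : F × F × F) : F :=
  a.1 * (b.2.1 * c.2.2 - b.2.2 * c.2.1) - a.2.1 * (b.1 * c.2.2 - b.2.2 * c.1) +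
    a.2.2 * (b.1 * c.2.1 - b.2.1 * c.1)

lemma exists_dotForm_eq {a b c : F × F × F} (h : det₃ a b c ≠ 0) (α β γ : F) :
    ∃ p, dotForm a p = α ∧ dotForm b p = β ∧ dotForm c p = γ := by
  have key := mul_inv_cancel₀ h
  -- Cramer's rule
  refine ⟨(det₃ a b c)⁻¹ •
    (α * (b.2.1 * c.2.2 - b.2.2 * c.2.1) + β * (c.2.1 * a.2.2 - c.2.2 * a.2.1) +
      γ * (a.2.1 * b.2.2 - a.2.2 * b.2.1),
    α * (b.2.2 * c.1 - b.1 * c.2.2) + β * (c.2.2 * a.1 - c.1 * a.2.2) +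
      γ * (a.2.2 * b.1 - a.1 * b.2.2),
    α * (b.1 * c.2.1 - b.2.1 * c.1) + β * (c.1 * a.2.1 - c.2.1 * a.1) +
      γ * (a.1 * b.2.1 - a.2.1 * b.1)), ?_, ?_, ?_⟩
  all_goals
    rw [map_smul, dotForm_apply, smul_eq_mul]
    generalize (det₃ a b c)⁻¹ = t at key ⊢
    unfold det₃ at key
  · linear_combination α * key
  · linear_combination β * key
  · linear_combination γ * key

lemma eq_zero_of_dotForm_eq_zero {a b c p : F × F × F} (h : det₃ a b c ≠ 0)
    (ha : dotForm a p = 0) (hb : dotForm b p = 0) (hc : dotForm c p = 0) : p = 0 := by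
  rw [dotForm_apply] at ha hb hc
  refine Prod.ext (mul_left_cancel₀ h ?_)
    (Prod.ext (mul_left_cancel₀ h ?_) (mul_left_cancel₀ h ?_))
  all_goals simp only [Prod.fst_zero, Prod.snd_zero, mul_zero, det₃]
  · linear_combination (b.2.1 * c.2.2 - b.2.2 * c.2.1) * ha +
      (c.2.1 * a.2.2 - c.2.2 * a.2.1) * hb + (a.2.1 * b.2.2 - a.2.2 * b.2.1) * hc
  · linear_combination (b.2.2 * c.1 - b.1 * c.2.2) * ha +
      (c.2.2 * a.1 - c.1 * a.2.2) * hb + (a.2.2 * b.1 - a.1 * b.2.2) * hc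
  · linear_combination (b.1 * c.2.1 - b.2.1 * c.1) * ha +
      (c.1 * a.2.1 - c.2.1 * a.1) * hb + (a.1 * b.2.1 - a.2.1 * b.1) * hc

/-- The linear dependence of four forms in three variables. -/
lemma det₃_dependence (a b c e p : F × F × F) :
    det₃ b c e * dotForm a p - det₃ a c e * dotForm b p + det₃ a b e * dotForm c p -
      det₃ a b c * dotForm e p = 0 := by
  simp only [dotForm_apply, det₃]; ring

lemma sign_mul_div_of_mul_pos {x y : F} (h : 0 < x * y) (v : F) :
    SignType.sign (v * (x / y)) = SignType.sign v := by
  have : 0 < x / y := by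
    rw [div_eq_mul_inv]
    rcases mul_pos_iff.1 h with ⟨h1, h2⟩ | ⟨h1, h2⟩
    · exact mul_pos h1 (inv_pos.2 h2)
    · exact mul_pos_of_neg_of_neg h1 (inv_lt_zero.2 h2)
  rw [sign_mul, sign_pos this, mul_one]

/-- Four forms in general position take a given system of signs as soon as four other forms with
the same orientations do: multiplying the values by the quotients of the coefficients of the two
linear dependences carries the one dependence to the other. -/
lemma exists_sign_eq_four {a b c e a' b' c' e' : F × F × F}
    (h₁ : 0 < det₃ b c e * det₃ b' c' e') (h₂ : 0 < det₃ a c e * det₃ a' c' e')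
    (h₃ : 0 < det₃ a b e * det₃ a' b' e') (h₄ : 0 < det₃ a b c * det₃ a' b' c')
    (p : F × F × F) :
    ∃ p', SignType.sign (dotForm a' p') = SignType.sign (dotForm a p) ∧
      SignType.sign (dotForm b' p') = SignType.sign (dotForm b p) ∧
      SignType.sign (dotForm c' p') = SignType.sign (dotForm c p) ∧
      SignType.sign (dotForm e' p') = SignType.sign (dotForm e p) := by
  have n₁ : det₃ b' c' e' ≠ 0 := right_ne_zero_of_mul h₁.ne'
  have n₂ : det₃ a' c' e' ≠ 0 := right_ne_zero_of_mul h₂.ne'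
  have n₃ : det₃ a' b' e' ≠ 0 := right_ne_zero_of_mul h₃.ne'
  have n₄ : det₃ a' b' c' ≠ 0 := right_ne_zero_of_mul h₄.ne'
  obtain ⟨p', ha, hb, hc⟩ := exists_dotForm_eq n₄
    (dotForm a p * (det₃ b c e / det₃ b' c' e')) (dotForm b p * (det₃ a c e / det₃ a' c' e'))
    (dotForm c p * (det₃ a b e / det₃ a' b' e'))
  have he : dotForm e' p' = dotForm e p * (det₃ a b c / det₃ a' b' c') := by
    have hdep := det₃_dependence a b c e p
    have hdep' := det₃_dependence a' b' c' e' p'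
    rw [ha, hb, hc] at hdep'
    refine mul_left_cancel₀ n₄ ?_
    have e₁ : det₃ b' c' e' * (dotForm a p * (det₃ b c e / det₃ b' c' e')) =
      dotForm a p * det₃ b c e := by field_simp
    have e₂ : det₃ a' c' e' * (dotForm b p * (det₃ a c e / det₃ a' c' e')) =
      dotForm b p * det₃ a c e := by field_simp
    have e₃ : det₃ a' b' e' * (dotForm c p * (det₃ a b e / det₃ a' b' e')) =
      dotForm c p * det₃ a b e := by field_simp
    have e₄ : det₃ a' b' c' * (dotForm e p * (det₃ a b c / det₃ a' b' c')) =
      dotForm e p * det₃ a b c := by field_simp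
    rw [e₁, e₂, e₃] at hdep'
    rw [e₄]
    linear_combination hdep - hdep'
  refine ⟨p', ?_, ?_, ?_, ?_⟩
  · rw [ha, sign_mul_div_of_mul_pos h₁]
  · rw [hb, sign_mul_div_of_mul_pos h₂]
  · rw [hc, sign_mul_div_of_mul_pos h₃]
  · rw [he, sign_mul_div_of_mul_pos h₄]

lemma convex_setOf_sign_eq {V : Type*} [AddCommGroup V] [Module F V] (ℓ : V →ₗ[F] F)
    (s : SignType) : Convex F {p | SignType.sign (ℓ p) = s} := by
  rcases s with _ | _ | _
  · simp only [SignType.zero_eq_zero, sign_eq_zero_iff]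
    exact convex_hyperplane ℓ.isLinear 0
  · simp only [SignType.neg_eq_neg_one, sign_eq_neg_one_iff]
    exact convex_halfSpace_lt ℓ.isLinear 0
  · simp only [SignType.pos_eq_one, sign_eq_one_iff]
    exact convex_halfSpace_gt ℓ.isLinear 0

/-- Two families of planes through the origin in general position, the corresponding triples of
which have the same orientations, have the same cells. By Helly's theorem it suffices to consider
four planes at a time. -/
lemma exists_signVec_eq {ι : Type*} [Fintype ι] (hcard : 3 ≤ Fintype.card ι)
    {a a' : ι → F × F × F} (hdet : ∀ i j k, i ≠ j → i ≠ k → j ≠ k →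
      0 < det₃ (a i) (a j) (a k) * det₃ (a' i) (a' j) (a' k)) (p : F × F × F) :
    ∃ p', signVec (fun i => dotForm (a' i)) p' = signVec (fun i => dotForm (a i)) p := by
  classical
  have hH : (⋂ i ∈ (Finset.univ : Finset ι),
      {p' | SignType.sign (dotForm (a' i) p') = SignType.sign (dotForm (a i) p)}).Nonempty := by
    refine Convex.helly_theorem' (𝕜 := F) (fun i _ => convex_setOf_sign_eq _ _) ?_
    intro I _ hI
    have hrank : Module.finrank F (F × F × F) = 3 := by simp
    rw [hrank] at hI
    rcases hI.eq_or_lt with h4 | h3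
    · obtain ⟨i, J, hiJ, rfl, hJ⟩ := Finset.card_eq_succ.1 h4
      obtain ⟨j, k, l, hjk, hjl, hkl, rfl⟩ := Finset.card_eq_three.1 hJ
      simp only [Finset.mem_insert, Finset.mem_singleton, not_or] at hiJ
      obtain ⟨hij, hik, hil⟩ := hiJ
      obtain ⟨p', h1, h2, h3, h4⟩ := exists_sign_eq_four (hdet j k l hjk hjl hkl)
        (hdet i k l hik hil hkl) (hdet i j l hij hil hjl) (hdet i j k hij hik hjk) p
      exact ⟨p', by simp [h1, h2, h3, h4]⟩
    · obtain ⟨J, hIJ, hJ⟩ := Finset.exists_superset_card_eq (Nat.lt_succ_iff.1 h3) hcard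
      obtain ⟨i, j, k, hij, hik, hjk, rfl⟩ := Finset.card_eq_three.1 hJ
      obtain ⟨p', h1, h2, h3⟩ := exists_dotForm_eq
        (right_ne_zero_of_mul (hdet i j k hij hik hjk).ne')
        (dotForm (a i) p) (dotForm (a j) p) (dotForm (a k) p)
      refine ⟨p', Set.mem_iInter₂.2 fun m hm => ?_⟩
      have hm' := hIJ hm
      simp only [Finset.mem_insert, Finset.mem_singleton] at hm'
      rcases hm' with rfl | rfl | rfl <;> simp [h1, h2, h3]
  obtain ⟨p', hp'⟩ := hH
  exact ⟨p', funext fun i => Set.mem_iInter₂.1 hp' i (Finset.mem_univ i)⟩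

/-- A conically piecewise linear map of `F × F × F`, restricted to the plane `z = 1` and followed by
the projection along the third coordinate, is piecewise linear. -/
lemma IsConicallyPiecewiseLinear.isPiecewiseLinear {f : F × F × F → F × F × F}
    (hf : IsConicallyPiecewiseLinear (F := F) f) :
    IsPiecewiseLinear fun p : F × F => ((f (p.1, p.2, 1)).1, (f (p.1, p.2, 1)).2.1) := by
  classical
  obtain ⟨𝒦, hfin, hcov, h⟩ := hf
  refine ⟨(fun K => {p : F × F | (p.1, p.2, (1 : F)) ∈ K}) '' 𝒦, hfin.image _, ?_, ?_⟩
  · refine Set.eq_univ_of_forall fun p => ?_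
    obtain ⟨K, hK, hp⟩ : (p.1, p.2, (1 : F)) ∈ ⋃₀ 𝒦 := hcov ▸ Set.mem_univ _
    exact ⟨_, ⟨K, hK, rfl⟩, hp⟩
  · rintro _ ⟨K, hK, rfl⟩
    obtain ⟨⟨s, rfl⟩, g, hg⟩ := h K hK
    have hlin : ∀ (φ : F × F × F →ₗ[F] F) (p : F × F),
        φ (p.1, p.2, 1) = p.1 • φ (1, 0, 0) + p.2 • φ (0, 1, 0) + φ (0, 0, 1) := by
      intro φ p
      rw [← map_smul, ← map_smul, ← map_add, ← map_add]
      simp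
    refine ⟨⟨s.image fun φ => (φ (1, 0, 0), φ (0, 1, 0), -φ (0, 0, 1)), ?_⟩, ?_⟩
    · ext p
      simp only [Set.mem_ofPred_eq, Finset.forall_mem_image]
      refine forall₂_congr fun φ _ => ?_
      rw [hlin φ p, smul_eq_mul, smul_eq_mul, le_neg_iff_add_nonpos_right, mul_comm p.1,
        mul_comm p.2]
    · let π : F × F × F →ₗ[F] F × F :=
        (LinearMap.fst F F (F × F)).prod (LinearMap.fst F F F ∘ₗ LinearMap.snd F F (F × F))
      let G : F × F →ₗ[F] F × F × F := (LinearMap.fst F F F).prod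
        ((LinearMap.snd F F F).prod 0)
      refine ⟨(π ∘ₗ g ∘ₗ G).toAffineMap + AffineMap.const F (F × F) (π (g (0, 0, 1))),
        fun p hp => ?_⟩
      have h1 : f (p.1, p.2, 1) = g (p.1, p.2, 1) := hg hp
      have h2 : (p.1, p.2, (1 : F)) = G p + (0, 0, 1) := by simp [G]
      change π (f (p.1, p.2, 1)) = π (g (G p)) + π (g (0, 0, 1))
      rw [h1, h2, map_add, map_add]

/-- The coefficients of the homogenized equation of the line `cross d p = γ`; the line at infinity
has the index `none`. -/
def lineCoeff {n : ℕ} (d : Fin n → F × F) (γ : Fin n → F) : Option (Fin n) → F × F × F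
  | none => (0, 0, 1)
  | some i => (-(d i).2, (d i).1, -γ i)

lemma tripleDet_swap_left {ι : Type*} (d : ι → F × F) (γ : ι → F) (i j k : ι) :
    tripleDet d γ j i k = -tripleDet d γ i j k := by
  simp only [tripleDet, cross]; ring

lemma tripleDet_swap_right {ι : Type*} (d : ι → F × F) (γ : ι → F) (i j k : ι) :
    tripleDet d γ i k j = -tripleDet d γ i j k := by
  simp only [tripleDet, cross]; ring

lemma dotForm_lineCoeff_some {n : ℕ} (d : Fin n → F × F) (γ : Fin n → F) (i : Fin n)
    (p : F × F) : dotForm (lineCoeff d γ (some i)) (p.1, p.2, 1) = cross (d i) p - γ i := by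
  simp only [dotForm_apply, lineCoeff, cross]; ring

lemma det₃_lineCoeff_mul_pos {n : ℕ} {d d' : Fin n → F × F} {γ γ' : Fin n → F}
    (hd : ∀ i j, i ≠ j → 0 < cross (d i) (d j) * cross (d' i) (d' j))
    (hD : ∀ i j k, i ≠ j → i ≠ k → j ≠ k → 0 < tripleDet d γ i j k * tripleDet d' γ' i j k)
    (i j k : Option (Fin n)) (hij : i ≠ j) (hik : i ≠ k) (hjk : j ≠ k) :
    0 < det₃ (lineCoeff d γ i) (lineCoeff d γ j) (lineCoeff d γ k) *
      det₃ (lineCoeff d' γ' i) (lineCoeff d' γ' j) (lineCoeff d' γ' k) := by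
  rcases i with _ | i <;> rcases j with _ | j <;> rcases k with _ | k
  any_goals exact absurd rfl ‹_›
  · refine (hd j k (by simpa using hjk)).trans_eq ?_
    simp only [det₃, lineCoeff, cross]; ring
  · refine (hd i k (by simpa using hik)).trans_eq ?_
    simp only [det₃, lineCoeff, cross]; ring
  · refine (hd i j (by simpa using hij)).trans_eq ?_
    simp only [det₃, lineCoeff, cross]; ring
  · refine (hD i j k (by simpa using hij) (by simpa using hik) (by simpa using hjk)).trans_eq ?_
    simp only [det₃, lineCoeff, cross, tripleDet]; ring

/-- Two arrangements of at least two lines with the same orders of the slopes and the same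
orientations of all triangles are related by a piecewise linear automorphism of the plane. -/
theorem exists_equiv_of_tripleDet_mul_pos {n : ℕ} (hn : 2 ≤ n) {d d' : Fin n → F × F}
    {γ γ' : Fin n → F} (hd : ∀ i j, i ≠ j → 0 < cross (d i) (d j) * cross (d' i) (d' j))
    (hD : ∀ i j k, i ≠ j → i ≠ k → j ≠ k → 0 < tripleDet d γ i j k * tripleDet d' γ' i j k) :
    ∃ e : F × F ≃ F × F, IsPiecewiseLinear e ∧ IsPiecewiseLinear e.symm ∧
      ∀ i p, cross (d' i) (e p) = γ' i ↔ cross (d i) p = γ i := by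
  have hdet := det₃_lineCoeff_mul_pos hd hD
  have hdet' : ∀ i j k : Option (Fin n), i ≠ j → i ≠ k → j ≠ k →
      0 < det₃ (lineCoeff d' γ' i) (lineCoeff d' γ' j) (lineCoeff d' γ' k) *
        det₃ (lineCoeff d γ i) (lineCoeff d γ j) (lineCoeff d γ k) := fun i j k h1 h2 h3 => by
    rw [mul_comm]; exact hdet i j k h1 h2 h3
  have hcard : 3 ≤ Fintype.card (Option (Fin n)) := by simp; omega
  have hthree := hdet none (some ⟨0, by omega⟩) (some ⟨1, by omega⟩) (by simp) (by simp) (by simp)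
  obtain ⟨e, he, he', hsign, hz⟩ := exists_conic_equiv
    (ℓ := fun i => dotForm (lineCoeff d γ i)) (ℓ' := fun i => dotForm (lineCoeff d' γ' i))
    (fun p hp => eq_zero_of_dotForm_eq_zero (left_ne_zero_of_mul hthree.ne') (hp _) (hp _) (hp _))
    (fun p hp => eq_zero_of_dotForm_eq_zero (right_ne_zero_of_mul hthree.ne') (hp _) (hp _) (hp _))
    (exists_signVec_eq hcard hdet) (exists_signVec_eq hcard hdet') none
  have hz' : ∀ v, (e v).2.2 = v.2.2 := by
    intro v
    have := hz v
    simpa [dotForm_apply, lineCoeff] using this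
  have hz'' : ∀ v, (e.symm v).2.2 = v.2.2 := by
    intro v
    rw [← hz', e.apply_symm_apply]
  have hlift : ∀ p : F × F, ((e (p.1, p.2, 1)).1, (e (p.1, p.2, 1)).2.1, (1 : F)) =
      e (p.1, p.2, 1) := fun p => Prod.ext rfl (Prod.ext rfl (hz' (p.1, p.2, 1)).symm)
  have hlift' : ∀ p : F × F, ((e.symm (p.1, p.2, 1)).1, (e.symm (p.1, p.2, 1)).2.1, (1 : F)) =
      e.symm (p.1, p.2, 1) := fun p => Prod.ext rfl (Prod.ext rfl (hz'' (p.1, p.2, 1)).symm)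
  refine ⟨⟨fun p => ((e (p.1, p.2, 1)).1, (e (p.1, p.2, 1)).2.1),
    fun p => ((e.symm (p.1, p.2, 1)).1, (e.symm (p.1, p.2, 1)).2.1), fun p => ?_, fun p => ?_⟩,
    he.isPiecewiseLinear, he'.isPiecewiseLinear, fun i p => ?_⟩
  · simp only [hlift, e.symm_apply_apply]
  · simp only [hlift', e.apply_symm_apply]
  · have h1 := dotForm_lineCoeff_some d' γ' i ((e (p.1, p.2, 1)).1, (e (p.1, p.2, 1)).2.1)
    simp only [hlift] at h1
    have h2 := dotForm_lineCoeff_some d γ i p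
    have h3 : SignType.sign (dotForm (lineCoeff d' γ' (some i)) (e (p.1, p.2, 1))) =
      SignType.sign (dotForm (lineCoeff d γ (some i)) (p.1, p.2, 1)) :=
      congrFun (hsign (p.1, p.2, 1)) (some i)
    rw [h1, h2] at h3
    change cross (d' i) ((e (p.1, p.2, 1)).1, (e (p.1, p.2, 1)).2.1) = γ' i ↔ _
    rw [← sub_eq_zero, ← sign_eq_zero_iff, h3, sign_eq_zero_iff, sub_eq_zero]

/-! ### Nook points determine the orientations of triangles -/

/-- A symmetric relation on triples of distinct elements that is unaffected by replacing the third
element holds for all such triples or for none. -/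
lemma iff_of_exchange {ι : Type*} {R : ι → ι → ι → Prop}
    (hleft : ∀ a b c, R a b c → R b a c) (hright : ∀ a b c, R a b c → R a c b)
    (hex : ∀ a b c e, a ≠ b → a ≠ c → a ≠ e → b ≠ c → b ≠ e → c ≠ e → R a b c → R a b e)
    {a b c x y z : ι} (hab : a ≠ b) (hac : a ≠ c) (hbc : b ≠ c) (hxy : x ≠ y) (hxz : x ≠ z)
    (hyz : y ≠ z) (h : R a b c) : R x y z := by
  obtain ⟨b₁, c₁, hxb, hxc, hbc₁, h₁⟩ : ∃ b₁ c₁, x ≠ b₁ ∧ x ≠ c₁ ∧ b₁ ≠ c₁ ∧ R x b₁ c₁ := by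
    by_cases h1 : x = a
    · subst h1; exact ⟨b, c, hab, hac, hbc, h⟩
    by_cases h2 : x = b
    · subst h2; exact ⟨a, c, hab.symm, hbc, hac, hleft _ _ _ h⟩
    by_cases h3 : x = c
    · subst h3
      exact ⟨a, b, hac.symm, hbc.symm, hab, hleft _ _ _ (hright _ _ _ h)⟩
    · exact ⟨b, c, h2, h3, hbc, hleft _ _ _ (hright _ _ _ (hex b c a x hbc hab.symm (Ne.symm h2)
        hac.symm (Ne.symm h3) (Ne.symm h1) (hright _ _ _ (hleft _ _ _ h))))⟩
  obtain ⟨c₂, hxc₂, hyc₂, h₂⟩ : ∃ c₂, x ≠ c₂ ∧ y ≠ c₂ ∧ R x y c₂ := by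
    by_cases h1 : y = b₁
    · subst h1; exact ⟨c₁, hxc, hbc₁, h₁⟩
    by_cases h2 : y = c₁
    · subst h2; exact ⟨b₁, hxb, hbc₁.symm, hright _ _ _ h₁⟩
    · exact ⟨c₁, hxc, h2, hright _ _ _ (hex x c₁ b₁ y hxc hxb hxy hbc₁.symm (Ne.symm h2)
        (Ne.symm h1) (hright _ _ _ h₁))⟩
  by_cases h1 : c₂ = z
  · subst h1; exact h₂
  · exact hex x y c₂ z hxy hxc₂ hxz hyc₂ hyz h1 h₂

/-- The Plücker relation `[ab][ce] - [ac][be] + [ae][bc] = 0` implies that at most one of the three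
pairings of four directions is interleaved. -/
lemma cross_pairings (a b c e : F × F) (h : cross a c * cross a e * (cross b c * cross b e) < 0) :
    0 < cross a b * cross a e * (cross c b * cross c e) ∧
      0 < cross a b * cross a c * (cross e b * cross e c) := by
  have hpl : cross a b * cross c e - cross a c * cross b e + cross a e * cross b c = 0 := by
    simp only [cross]; ring
  rw [cross_swap c b, cross_swap e b, cross_swap e c]
  constructor
  · have := sq_nonneg (cross a e * cross b c)
    linear_combination h + this + (cross a e * cross b c) * hpl
  · have := sq_nonneg (cross a c * cross b e)
    linear_combination h + this - (cross a c * cross b e) * hpl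

lemma mul_pos_of_neg_iff {x x' s s' t t' : F} (hx : x ≠ 0) (hx' : x' ≠ 0) (hst : 0 < s * t)
    (hs : 0 < s * s') (ht : 0 < t * t')
    (h : (x * s < 0 ∧ x * t < 0) ↔ (x' * s' < 0 ∧ x' * t' < 0)) : 0 < x * x' := by
  rcases mul_pos_iff.1 hst with ⟨h1, h2⟩ | ⟨h1, h2⟩
  · have h3 := (pos_iff_pos_of_mul_pos hs).1 h1
    have h4 := (pos_iff_pos_of_mul_pos ht).1 h2
    rw [mul_neg_iff_of_pos h1, mul_neg_iff_of_pos h2, mul_neg_iff_of_pos h3,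
      mul_neg_iff_of_pos h4, and_self, and_self] at h
    rcases lt_or_gt_of_ne hx with h5 | h5
    · exact mul_pos_of_neg_of_neg h5 (h.1 h5)
    · exact mul_pos h5 (lt_of_le_of_ne (not_lt.1 fun h6 => h5.not_gt (h.2 h6)) hx'.symm)
  · have h3 := (neg_iff_neg_of_mul_pos hs).1 h1
    have h4 := (neg_iff_neg_of_mul_pos ht).1 h2
    have hn : ∀ {y u : F}, u < 0 → (y * u < 0 ↔ 0 < y) := fun {y u} hu => by
      rw [← neg_mul_neg, mul_neg_iff_of_pos (neg_pos.2 hu), neg_lt_zero]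
    rw [hn h1, hn h2, hn h3, hn h4, and_self, and_self] at h
    rcases lt_or_gt_of_ne hx with h5 | h5
    · exact mul_pos_of_neg_of_neg h5
        (lt_of_le_of_ne (not_lt.1 fun h6 => h5.not_gt (h.2 h6)) hx')
    · exact mul_pos h5 (h.1 h5)

section Orientations

variable {n : ℕ} {L M : Fin n → AffineSubspace F (F × F)} {d d' : Fin n → F × F}
  {γ γ' : Fin n → F}

/-- If the pairs `{a, b}` and `{c, e}` of slopes are not interleaved, then whether the nook point
of the four lines lies on `a` and `b` tells whether the triangles `abc` and `abe` have the same
orientation. -/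
lemma tripleDet_mul_pos_of_not_interleaved (hL : IsGenericSystem L d γ)
    (hM : IsGenericSystem M d' γ')
    (hd : ∀ i j, i ≠ j → 0 < cross (d i) (d j) * cross (d' i) (d' j))
    (hP : PreservesNookPoints L M (Equiv.refl (Fin n))) {a b c e : Fin n} (hab : a ≠ b)
    (hac : a ≠ c) (hae : a ≠ e) (hbc : b ≠ c) (hbe : b ≠ e) (hce : c ≠ e)
    (hsep : 0 < cross (d a) (d c) * cross (d a) (d e) * (cross (d b) (d c) * cross (d b) (d e)))
    (h : 0 < tripleDet d γ a b c * tripleDet d' γ' a b c) :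
    0 < tripleDet d γ a b e * tripleDet d' γ' a b e := by
  have hq : Function.Injective ![a, b, c, e] := by
    intro i j hij
    fin_cases i <;> fin_cases j <;> simp_all
  obtain ⟨P, hPa, hPb⟩ := exists_cross_eq (hL.cross_ne_zero a b hab) (γ a) (γ b)
  obtain ⟨P', hPa', hPb'⟩ := exists_cross_eq (hM.cross_ne_zero a b hab) (γ' a) (γ' b)
  rw [← hL.mem_iff] at hPa hPb
  rw [← hM.mem_iff] at hPa' hPb'
  have hnook := hP ⟨![a, b, c, e], hq⟩ 0 1 (by decide) P P' hPa hPb hPa' hPb'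
  have h1 := (hL.comp hq).isNookPoint_iff_tripleDet (i := 0) (j := 1) (k := 2) (l := 3)
    (by decide) (by decide) (by decide) (by decide) (by decide) (by decide) hPa hPb
  have h2 := (hM.comp hq).isNookPoint_iff_tripleDet (i := 0) (j := 1) (k := 2) (l := 3)
    (by decide) (by decide) (by decide) (by decide) (by decide) (by decide) hPa' hPb'
  have h3 := (h1.symm.trans hnook).trans h2
  change (tripleDet d γ a b c * tripleDet d γ a b e * (cross (d a) (d c) * cross (d a) (d e)) < 0 ∧
    tripleDet d γ a b c * tripleDet d γ a b e * (cross (d b) (d c) * cross (d b) (d e)) < 0) ↔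
    (tripleDet d' γ' a b c * tripleDet d' γ' a b e *
      (cross (d' a) (d' c) * cross (d' a) (d' e)) < 0 ∧
    tripleDet d' γ' a b c * tripleDet d' γ' a b e *
      (cross (d' b) (d' c) * cross (d' b) (d' e)) < 0) at h3
  have h4 := mul_pos_of_neg_iff
    (mul_ne_zero (hL.tripleDet_ne_zero hab hbc hac) (hL.tripleDet_ne_zero hab hbe hae))
    (mul_ne_zero (hM.tripleDet_ne_zero hab hbc hac) (hM.tripleDet_ne_zero hab hbe hae)) hsep
    (by rw [mul_mul_mul_comm]; exact mul_pos (hd a c hac) (hd a e hae))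
    (by rw [mul_mul_mul_comm]; exact mul_pos (hd b c hbc) (hd b e hbe)) h3
  rw [mul_mul_mul_comm] at h4
  exact (pos_iff_pos_of_mul_pos h4).1 h

/-- Up to a global change of sign, the nook points determine the orientations of all triangles. -/
lemma tripleDet_mul_pos_or_neg (hL : IsGenericSystem L d γ) (hM : IsGenericSystem M d' γ')
    (hd : ∀ i j, i ≠ j → 0 < cross (d i) (d j) * cross (d' i) (d' j))
    (hP : PreservesNookPoints L M (Equiv.refl (Fin n))) :
    (∀ i j k, i ≠ j → i ≠ k → j ≠ k → 0 < tripleDet d γ i j k * tripleDet d' γ' i j k) ∨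
      ∀ i j k, i ≠ j → i ≠ k → j ≠ k → tripleDet d γ i j k * tripleDet d' γ' i j k < 0 := by
  have hleft : ∀ a b c, 0 < tripleDet d γ a b c * tripleDet d' γ' a b c →
      0 < tripleDet d γ b a c * tripleDet d' γ' b a c := by
    intro a b c h
    rwa [tripleDet_swap_left, tripleDet_swap_left d', neg_mul_neg]
  have hright : ∀ a b c, 0 < tripleDet d γ a b c * tripleDet d' γ' a b c →
      0 < tripleDet d γ a c b * tripleDet d' γ' a c b := by
    intro a b c h
    rwa [tripleDet_swap_right, tripleDet_swap_right d', neg_mul_neg]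
  have hex : ∀ a b c e, a ≠ b → a ≠ c → a ≠ e → b ≠ c → b ≠ e → c ≠ e →
      0 < tripleDet d γ a b c * tripleDet d' γ' a b c →
      0 < tripleDet d γ a b e * tripleDet d' γ' a b e := by
    intro a b c e hab hac hae hbc hbe hce h
    have hne : cross (d a) (d c) * cross (d a) (d e) * (cross (d b) (d c) * cross (d b) (d e)) ≠ 0 :=
      mul_ne_zero (mul_ne_zero (hL.cross_ne_zero _ _ hac) (hL.cross_ne_zero _ _ hae))
        (mul_ne_zero (hL.cross_ne_zero _ _ hbc) (hL.cross_ne_zero _ _ hbe))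
    rcases lt_or_gt_of_ne hne with hneg | hpos
    · -- If `{a, b}` and `{c, e}` are interleaved, pass from `abc` to `abe` by way of `ace`.
      obtain ⟨h1, h2⟩ := cross_pairings (d a) (d b) (d c) (d e) hneg
      have h3 := tripleDet_mul_pos_of_not_interleaved hL hM hd hP hac hab hae hbc.symm hce hbe
        h1 (hright _ _ _ h)
      exact hright _ _ _ (tripleDet_mul_pos_of_not_interleaved hL hM hd hP hae hac hab hce.symm
        hbe.symm hbc.symm (by rwa [mul_comm (cross (d a) (d c)), mul_comm (cross (d e) (d c))])
        (hright _ _ _ h3))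
    · exact tripleDet_mul_pos_of_not_interleaved hL hM hd hP hab hac hae hbc hbe hce hpos h
  by_cases hall : ∃ i j k, i ≠ j ∧ i ≠ k ∧ j ≠ k ∧ 0 < tripleDet d γ i j k * tripleDet d' γ' i j k
  · obtain ⟨a, b, c, hab, hac, hbc, h⟩ := hall
    exact .inl fun i j k hij hik hjk =>
      iff_of_exchange (R := fun a b c => 0 < tripleDet d γ a b c * tripleDet d' γ' a b c)
        hleft hright hex hab hac hbc hij hik hjk h
  · refine .inr fun i j k hij hik hjk => lt_of_le_of_ne ?_
      (mul_ne_zero (hL.tripleDet_ne_zero hij hjk hik) (hM.tripleDet_ne_zero hij hjk hik))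
    exact not_lt.1 fun h => hall ⟨i, j, k, hij, hik, hjk, h⟩

end Orientations

/-! ### From nook points to isomorphisms and back -/

section Isomorphism

variable {n : ℕ} {L M : Fin n → AffineSubspace F (F × F)} {d d' : Fin n → F × F}
  {γ γ' : Fin n → F}

lemma isPiecewiseLinear_id : IsPiecewiseLinear (fun p : F × F => p) :=
  ⟨{Set.univ}, Set.finite_singleton _, by simp, by
    rintro _ rfl
    exact ⟨⟨∅, by simp⟩, AffineMap.id F _, fun _ _ => rfl⟩⟩

lemma IsPiecewiseLinear.neg {f : F × F → F × F} (hf : IsPiecewiseLinear f) :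
    IsPiecewiseLinear fun p => -f p := by
  obtain ⟨𝒦, hfin, hcov, h⟩ := hf
  refine ⟨𝒦, hfin, hcov, fun K hK => ⟨(h K hK).1, ?_⟩⟩
  obtain ⟨g, hg⟩ := (h K hK).2
  exact ⟨-g, fun p hp => congrArg Neg.neg (hg hp)⟩

lemma IsPiecewiseLinear.comp_neg {f : F × F → F × F} (hf : IsPiecewiseLinear f) :
    IsPiecewiseLinear fun p => f (-p) := by
  classical
  obtain ⟨𝒦, hfin, hcov, h⟩ := hf
  refine ⟨(fun K => {p | -p ∈ K}) '' 𝒦, hfin.image _, ?_, ?_⟩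
  · refine Set.eq_univ_of_forall fun p => ?_
    obtain ⟨K, hK, hp⟩ : -p ∈ ⋃₀ 𝒦 := hcov ▸ Set.mem_univ _
    exact ⟨_, ⟨K, hK, rfl⟩, hp⟩
  · rintro _ ⟨K, hK, rfl⟩
    obtain ⟨⟨s, rfl⟩, g, hg⟩ := h K hK
    refine ⟨⟨s.image fun h => (-h.1, -h.2.1, h.2.2), ?_⟩,
      g.comp (-(LinearMap.id : F × F →ₗ[F] F × F)).toAffineMap, fun p hp => hg hp⟩
    ext p
    simp only [Set.mem_ofPred_eq, Finset.forall_mem_image, Prod.fst_neg, Prod.snd_neg]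
    exact forall₂_congr fun h _ => by rw [mul_neg, neg_mul, mul_neg, neg_mul]

lemma isIsomorphism_of_equiv (hL : IsGenericSystem L d γ) (hM : IsGenericSystem M d' γ')
    {e : F × F ≃ F × F} (he : IsPiecewiseLinear e) (he' : IsPiecewiseLinear e.symm)
    (h : ∀ i p, cross (d' i) (e p) = γ' i ↔ cross (d i) p = γ i) :
    IsIsomorphism L M (Equiv.refl (Fin n)) := by
  refine ⟨e, he, he', fun i => ?_⟩
  ext p
  rw [Equiv.image_eq_preimage_symm, Set.mem_preimage, SetLike.mem_coe, SetLike.mem_coe,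
    hL.mem_iff, ← h, e.apply_symm_apply, Equiv.refl_apply, hM.mem_iff]

lemma isIsomorphism_of_preservesNookPoints (hL : IsGenericSystem L d γ)
    (hM : IsGenericSystem M d' γ')
    (hd : ∀ i j, i ≠ j → 0 < cross (d i) (d j) * cross (d' i) (d' j))
    (hP : PreservesNookPoints L M (Equiv.refl (Fin n))) :
    IsIsomorphism L M (Equiv.refl (Fin n)) := by
  obtain hn | rfl | rfl : 2 ≤ n ∨ n = 1 ∨ n = 0 := by omega
  · rcases tripleDet_mul_pos_or_neg hL hM hd hP with h | h
    · obtain ⟨e, he, he', hmem⟩ := exists_equiv_of_tripleDet_mul_pos hn hd h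
      exact isIsomorphism_of_equiv hL hM he he' hmem
    · -- The half-turn `p ↦ -p` keeps the slopes and reverses the orientations of all triangles.
      have h' : ∀ i j k, i ≠ j → i ≠ k → j ≠ k →
          0 < tripleDet d γ i j k * tripleDet d' (-γ') i j k := by
        intro i j k hij hik hjk
        have := h i j k hij hik hjk
        have hneg : tripleDet d' (-γ') i j k = -tripleDet d' γ' i j k := by
          simp only [tripleDet, Pi.neg_apply]; ring
        rw [hneg, mul_neg]
        exact neg_pos.2 this
      obtain ⟨e, he, he', hmem⟩ := exists_equiv_of_tripleDet_mul_pos hn hd h'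
      refine isIsomorphism_of_equiv hL hM (e := e.trans (Equiv.neg _)) he.neg he'.comp_neg
        fun i p => ?_
      rw [← hmem i p, Pi.neg_apply, ← neg_inj, neg_inj, Equiv.trans_apply, Equiv.neg_apply]
      have : cross (d' i) (-e p) = -cross (d' i) (e p) := by
        simp only [cross, Prod.fst_neg, Prod.snd_neg]; ring
      rw [this, neg_eq_iff_eq_neg]
  · -- A single line is completed to a pair of perpendicular lines.
    have hrot : ∀ v : F × F, v ≠ 0 → 0 < cross v (-v.2, v.1) := by
      intro v hv
      have : cross v (-v.2, v.1) = v.1 ^ 2 + v.2 ^ 2 := by simp only [cross]; ring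
      rw [this]
      refine lt_of_le_of_ne (by positivity) fun h0 => hv (Prod.ext ?_ ?_)
      · simp only [Prod.fst_zero]; nlinarith [sq_nonneg v.1, sq_nonneg v.2]
      · simp only [Prod.snd_zero]; nlinarith [sq_nonneg v.1, sq_nonneg v.2]
    obtain ⟨e, he, he', hmem⟩ := exists_equiv_of_tripleDet_mul_pos (n := 2) le_rfl
      (d := ![d 0, (-(d 0).2, (d 0).1)]) (d' := ![d' 0, (-(d' 0).2, (d' 0).1)])
      (γ := ![γ 0, 0]) (γ' := ![γ' 0, 0])
      (by
        have h1 := mul_pos (hrot _ (hL.ne_zero 0)) (hrot _ (hM.ne_zero 0))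
        intro i j hij
        fin_cases i <;> fin_cases j
        · exact absurd rfl hij
        · exact h1
        · change 0 < cross (-(d 0).2, (d 0).1) (d 0) * cross (-(d' 0).2, (d' 0).1) (d' 0)
          rw [cross_swap, cross_swap (-(d' 0).2, (d' 0).1), neg_mul_neg]
          exact h1
        · exact absurd rfl hij)
      (fun i j k _ _ _ => by omega)
    refine isIsomorphism_of_equiv hL hM he he' fun i p => ?_
    rw [Subsingleton.elim i 0]
    exact hmem 0 p
  · exact ⟨Equiv.refl _, isPiecewiseLinear_id, isPiecewiseLinear_id, fun i => i.elim0⟩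

lemma preservesNookPoints_of_isIsomorphism (hL : IsGenericSystem L d γ)
    (hM : IsGenericSystem M d' γ') {φ : Equiv.Perm (Fin n)} (h : IsIsomorphism L M φ) :
    PreservesNookPoints L M φ ∧ ∀ (q : Fin 4 ↪ Fin n) (i j : Fin 4),
      NookAt (fun r => L (q r)) i j ↔ NookAt (fun r => M (φ (q r))) i j := by
  obtain ⟨e, he, he', heL⟩ := h
  have h1 : ∀ i, ∀ p ∈ L i, e p ∈ M (φ i) := fun i p hp => by
    have : e p ∈ (M (φ i) : Set (F × F)) := heL i ▸ Set.mem_image_of_mem e hp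
    exact this
  have h2 : ∀ i, ∀ p ∈ M (φ i), e.symm p ∈ L i := fun i p hp => by
    have : p ∈ e '' (L i : Set (F × F)) := (heL i).symm ▸ hp
    obtain ⟨p', hp', rfl⟩ := this
    rwa [e.symm_apply_apply]
  have hLq := fun q : Fin 4 ↪ Fin n => hL.comp q.injective
  have hMq := fun q : Fin 4 ↪ Fin n => hM.comp (φ.injective.comp q.injective)
  have hmap : ∀ (q : Fin 4 ↪ Fin n) P, IsNookPoint (fun r => L (q r)) P →
      IsNookPoint (fun r => M (φ (q r))) (e P) := fun q P hP =>
    hP.map (hLq q) (hMq q) he e.injective fun r => h1 (q r)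
  have hmap' : ∀ (q : Fin 4 ↪ Fin n) P, IsNookPoint (fun r => M (φ (q r))) P →
      IsNookPoint (fun r => L (q r)) (e.symm P) := fun q P hP =>
    hP.map (hMq q) (hLq q) he' e.symm.injective fun r => h2 (q r)
  constructor
  · intro q i j hij P P' hi hj hi' hj'
    have hP' : P' = e P := by
      have hi'' := h1 _ _ hi
      have hj'' := h1 _ _ hj
      rw [hM.mem_iff] at hi' hj' hi'' hj''
      have hne := hM.cross_ne_zero _ _ (φ.injective.ne (q.injective.ne hij))
      have hsub : ∀ v : F × F, cross v P' = cross v (e P) → cross v (P' - e P) = 0 := by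
        intro v hv
        simp only [cross, Prod.fst_sub, Prod.snd_sub] at hv ⊢
        linear_combination hv
      obtain ⟨s, hs⟩ := exists_eq_smul_of_cross_eq_zero (hM.ne_zero (φ (q i)))
        (hsub _ (hi'.trans hi''.symm))
      have h0 := hsub _ (hj'.trans hj''.symm)
      rw [hs, cross_smul_right, cross_swap] at h0
      rcases mul_eq_zero.1 h0 with h0 | h0
      · rw [h0, zero_smul, sub_eq_zero] at hs
        exact hs
      · exact absurd (neg_eq_zero.1 h0) hne
    rw [hP']
    refine ⟨hmap q P, fun h => ?_⟩
    have := hmap' q _ h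
    rwa [e.symm_apply_apply] at this
  · intro q i j
    constructor
    · rintro ⟨hij, P, hi, hj, hP⟩
      exact ⟨hij, e P, h1 _ _ hi, h1 _ _ hj, hmap q P hP⟩
    · rintro ⟨hij, P, hi, hj, hP⟩
      exact ⟨hij, e.symm P, h2 _ _ hi, h2 _ _ hj, hmap' q P hP⟩

end Isomorphism

end LineArr

theorem theorem5 {F : Type*} [Field F] [LinearOrder F] [IsStrictOrderedRing F] (n : ℕ)
    (L M : Fin n → AffineSubspace F (F × F))
    (hL : LineArr.IsLineArrangement L) (hM : LineArr.IsLineArrangement M)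
    (hLs : LineArr.SlopeOrdered L) (hMs : LineArr.SlopeOrdered M) :
    (LineArr.IsIsomorphism L M (Equiv.refl (Fin n)) ↔
      LineArr.PreservesNookPoints L M (Equiv.refl (Fin n))) ∧
    -- The hypothesis of the next part holds with `j = 0` in the case of the equivalence above.
    ((∃ j : ℤ, LineArr.IsIsomorphism L M (finRotate n ^ j)) →
      (∃ k : ℤ, LineArr.IdenticalNookPoints (LineArr.renumber k L) M) ∧
      (∃ k : ℤ, LineArr.IdenticalNookPoints L (LineArr.renumber k M))) := by
  open LineArr in
  obtain ⟨d, γ, hLd, hd⟩ := exists_isGenericSystem hL hLs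
  obtain ⟨d', γ', hMd, hd'⟩ := exists_isGenericSystem hM hMs
  have hdd : ∀ i j, i ≠ j → 0 < cross (d i) (d j) * cross (d' i) (d' j) := by
    intro i j hij
    rcases lt_or_gt_of_ne hij with h | h
    · exact mul_pos (hd i j h) (hd' i j h)
    · rw [cross_swap, cross_swap (d' i), neg_mul_neg]
      exact mul_pos (hd j i h) (hd' j i h)
  refine ⟨⟨fun h => (preservesNookPoints_of_isIsomorphism hLd hMd h).1,
    isIsomorphism_of_preservesNookPoints hLd hMd hdd⟩, ?_⟩
  rintro ⟨j, hj⟩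
  have h := (preservesNookPoints_of_isIsomorphism hLd hMd hj).2
  refine ⟨⟨-j, fun q a b => ?_⟩, ⟨j, h⟩⟩
  have := h (q.trans (finRotate n ^ (-j)).toEmbedding) a b
  simpa [renumber, zpow_neg] using this
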